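/- Let $\theta_3(x)=\sum_{n=-\infty}^{\infty} e^{-\pi n^2 x}$ for complex $x$ with $\operatorname{Re}x>0$, and let $\Omega=\dfrac{\Gamma(1/4)^8}{32\pi^4}$, where $\Gamma$ is the Euler gamma function. There exists a sequence of integers $$(d(n))_{n=0}^{\infty}=1,\,1,\,-1,\,51,\,849,\,-26199,\,1341999,\ldots$$ such that for every integer $n\ge 0$ the $n$th derivative of $\theta_3$ at $1$ is $$\theta_3^{(n)}(1)=\theta_3(1)\cdot\frac{(-1)^n}{4^n}\sum_{k=0}^{\lfloor n/2\rfloor}\frac{(2n)!}{2^{n-2k}\,(4k)!\,(n-2k)!}\,d(k)\,\Omega^k .$$ -/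

import Mathlib

/-- The Jacobi theta constant `θ₃(x) = ∑_{n ∈ ℤ} exp (-π n² x)`, used on the half-plane `Re x > 0`,
where the series converges absolutely (see `summable_jacobiTheta3`). -/
noncomputable def jacobiTheta3 (x : ℂ) : ℂ :=
  ∑' n : ℤ, Complex.exp (-(Real.pi : ℂ) * (n : ℂ) ^ 2 * x)

/-- The constant `Ω = Γ(1/4)⁸ / (32 π⁴)`. -/
noncomputable def thetaOmega : ℝ :=
  Real.Gamma (1 / 4) ^ 8 / (32 * Real.pi ^ 4)

theorem jacobiTheta3_term_eq (x : ℂ) (n : ℤ) :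
    Complex.exp (-(Real.pi : ℂ) * (n : ℂ) ^ 2 * x) =
      Complex.exp (Real.pi * Complex.I * (n : ℂ) ^ 2 * (Complex.I * x)) := by
  congr 1
  linear_combination (-(Real.pi : ℂ) * (n : ℂ) ^ 2 * x) * Complex.I_mul_I

theorem jacobiTheta3_eq_jacobiTheta (x : ℂ) : jacobiTheta3 x = jacobiTheta (Complex.I * x) := by
  simp only [jacobiTheta3, jacobiTheta, jacobiTheta3_term_eq]

/-- The series that defines `θ₃` converges on the right half-plane. -/
theorem summable_jacobiTheta3 {x : ℂ} (hx : 0 < x.re) :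
    Summable fun n : ℤ => Complex.exp (-(Real.pi : ℂ) * (n : ℂ) ^ 2 * x) := by
  have h := (summable_jacobiTheta₂_term_iff 0 (Complex.I * x)).2 (by simpa using hx)
  refine h.congr fun n => ?_
  rw [jacobiTheta3_term_eq, jacobiTheta₂_term]
  simp

/-- `θ₃` is holomorphic on the right half-plane. -/
theorem differentiableOn_jacobiTheta3 :
    DifferentiableOn ℂ jacobiTheta3 {x : ℂ | 0 < x.re} := by
  have e : jacobiTheta3 = fun x => jacobiTheta (Complex.I * x) :=
    funext jacobiTheta3_eq_jacobiTheta
  intro x hx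
  have hτ : 0 < (Complex.I * x).im := by simpa using hx
  rw [e]
  exact ((differentiableAt_jacobiTheta hτ).comp x
    (differentiableAt_id.const_mul Complex.I)).differentiableWithinAt

/-! Write θ₄(x) = θ₃(x + i), and let L₃, L₄ be the logarithmic derivatives. The analytic input is
Gauss' pair of doubling formulas, `two_mul_thetaThree_two_mul_sq` and `thetaFour_two_mul_sq`,
together with the remark that a function on (0, ∞) invariant under x ↦ 2x equals its limit at
infinity (`eq_of_two_mul_eq_of_tendsto`). Applied three times, this yields L₃ - L₄ = -(π/4)(θ₃⁴ -
θ₄⁴), Jacobi's differential equation `hasDerivAt_logDerivThree`, and the elliptic integral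
`gaussIntegral_thetaThree_sq_thetaFour_sq`.

Put v = L₃/2, let W be a multiple of θ₃⁴, and let m be the centred modulus. The system closes: v' =
4v² + W²(1 - 8m²)/2, W' = 8vW, m' = W(1 - 8m²). Removing the v-terms from successive derivatives
leaves G_j = θ₃ W^j P_j(m) with integer polynomials P_j (`thetaPoly`), and the nth derivative of θ₃
is ∑ c(n,j) v^(n-j) G_j with c(n,j) = (2n)!/((2j)!(n-j)!); the induction step is
`covariantSum_succ`.

At the fixed point 1 of x ↦ 1/x one has m = 0, v = -1/8, and W² = Ω/16, the last because the
elliptic integral becomes lemniscatic there (`thetaOmega_eq`). Since P_j has the parity of j, only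
even j contribute, and d(k) = P_{2k}(0). -/

/-! ### θ₃ and θ₄ as real functions -/

/-- The derivative of order `k` of `θ₃` along the horizontal line through `w`, real part. -/
noncomputable def thetaLine (w : ℂ) (k : ℕ) (x : ℝ) : ℝ :=
  (iteratedDeriv k jacobiTheta3 (x + w)).re

theorem isOpen_rightHalfPlane : IsOpen {x : ℂ | 0 < x.re} :=
  isOpen_lt continuous_const Complex.continuous_re

theorem differentiableAt_iteratedDeriv_jacobiTheta3 (k : ℕ) {z : ℂ} (hz : 0 < z.re) :
    DifferentiableAt ℂ (iteratedDeriv k jacobiTheta3) z := by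
  have h : DifferentiableOn ℂ (iteratedDeriv k jacobiTheta3) {x : ℂ | 0 < x.re} := by
    induction k with
    | zero => simpa using differentiableOn_jacobiTheta3
    | succ k ih =>
      rw [iteratedDeriv_succ]
      exact ih.deriv isOpen_rightHalfPlane
  exact h.differentiableAt (isOpen_rightHalfPlane.mem_nhds hz)

theorem hasDerivAt_thetaLine {w : ℂ} (hw : w.re = 0) (k : ℕ) {x : ℝ} (hx : 0 < x) :
    HasDerivAt (thetaLine w k) (thetaLine w (k + 1) x) x := by
  have h := (differentiableAt_iteratedDeriv_jacobiTheta3 k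
    (z := (x : ℂ) + w) (by simpa [hw] using hx)).hasDerivAt
  rw [← iteratedDeriv_succ] at h
  exact (h.comp_add_const (x : ℂ) w).real_of_complex

/-- `θ₃` on the positive real axis. -/
noncomputable def thetaThree : ℝ → ℝ := thetaLine 0 0

/-- `θ₄` on the positive real axis. -/
noncomputable def thetaFour : ℝ → ℝ := thetaLine Complex.I 0

theorem summable_exp_neg_pi_sq {x : ℝ} (hx : 0 < x) :
    Summable fun n : ℤ => Real.exp (-Real.pi * (n : ℝ) ^ 2 * x) := by
  have h := (summable_jacobiTheta3 (x := (x : ℂ)) (by simpa using hx)).norm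
  refine h.congr fun n => ?_
  rw [Complex.norm_exp]
  congr 1
  have : (-(Real.pi : ℂ) * (n : ℂ) ^ 2 * x) = ((-Real.pi * (n : ℝ) ^ 2 * x : ℝ) : ℂ) := by
    push_cast; ring
  rw [this, Complex.ofReal_re]

theorem jacobiTheta3_ofReal (x : ℝ) :
    jacobiTheta3 x = ((∑' n : ℤ, Real.exp (-Real.pi * (n : ℝ) ^ 2 * x) : ℝ) : ℂ) := by
  rw [jacobiTheta3, Complex.ofReal_tsum]
  congr 1
  ext n
  push_cast
  rfl

theorem exp_neg_pi_sq_mul_I (n : ℤ) :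
    Complex.exp (-(Real.pi : ℂ) * (n : ℂ) ^ 2 * Complex.I) = (((-1 : ℝ) ^ n.natAbs : ℝ) : ℂ) := by
  have h : (-(Real.pi : ℂ) * (n : ℂ) ^ 2 * Complex.I)
      = ((-n ^ 2 : ℤ) : ℂ) * (Real.pi * Complex.I) := by
    push_cast; ring
  rw [h, Complex.exp_int_mul, Complex.exp_pi_mul_I]
  rcases Int.even_or_odd n with hn | hn
  · have h2 : Even (-n ^ 2) := (hn.pow_of_ne_zero two_ne_zero).neg
    rw [h2.neg_one_zpow, (Int.natAbs_even.2 hn).neg_one_pow]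
    simp
  · have h2 : Odd (-n ^ 2) := hn.pow.neg
    rw [h2.neg_one_zpow, (Int.natAbs_odd.2 hn).neg_one_pow]
    simp

theorem jacobiTheta3_ofReal_add_I (x : ℝ) :
    jacobiTheta3 (x + Complex.I) =
      ((∑' n : ℤ, (-1) ^ n.natAbs * Real.exp (-Real.pi * (n : ℝ) ^ 2 * x) : ℝ) : ℂ) := by
  rw [jacobiTheta3, Complex.ofReal_tsum]
  congr 1
  ext n
  rw [mul_add, Complex.exp_add, exp_neg_pi_sq_mul_I, mul_comm]
  push_cast
  rfl

theorem thetaThree_eq_tsum (x : ℝ) :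
    thetaThree x = ∑' n : ℤ, Real.exp (-Real.pi * (n : ℝ) ^ 2 * x) := by
  simp only [thetaThree, thetaLine, iteratedDeriv_zero, add_zero, jacobiTheta3_ofReal,
    Complex.ofReal_re]

theorem thetaFour_eq_tsum (x : ℝ) :
    thetaFour x = ∑' n : ℤ, (-1) ^ n.natAbs * Real.exp (-Real.pi * (n : ℝ) ^ 2 * x) := by
  simp only [thetaFour, thetaLine, iteratedDeriv_zero, jacobiTheta3_ofReal_add_I,
    Complex.ofReal_re]

theorem jacobiTheta3_ofReal_eq_thetaThree (x : ℝ) : jacobiTheta3 x = (thetaThree x : ℂ) := by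
  rw [jacobiTheta3_ofReal, thetaThree_eq_tsum]

theorem summable_alternating_exp_neg_pi_sq {x : ℝ} (hx : 0 < x) :
    Summable fun n : ℤ => (-1 : ℝ) ^ n.natAbs * Real.exp (-Real.pi * (n : ℝ) ^ 2 * x) := by
  refine Summable.of_norm ?_
  simpa [abs_mul, abs_pow] using summable_exp_neg_pi_sq hx

theorem one_lt_thetaThree {x : ℝ} (hx : 0 < x) : 1 < thetaThree x := by
  rw [thetaThree_eq_tsum]
  have h := (summable_exp_neg_pi_sq hx).sum_le_tsum {0, 1} fun n _ => (Real.exp_pos _).le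
  refine lt_of_lt_of_le ?_ h
  simp [Real.exp_pos]

theorem thetaThree_pos {x : ℝ} (hx : 0 < x) : 0 < thetaThree x :=
  zero_lt_one.trans (one_lt_thetaThree hx)

theorem thetaFour_lt_thetaThree {x : ℝ} (hx : 0 < x) : thetaFour x < thetaThree x := by
  rw [thetaThree_eq_tsum, thetaFour_eq_tsum]
  refine (summable_alternating_exp_neg_pi_sq hx).tsum_lt_tsum (i := 1) (fun n => ?_) ?_
    (summable_exp_neg_pi_sq hx)
  · have h : (-1 : ℝ) ^ n.natAbs ≤ 1 := (le_abs_self _).trans (by simp)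
    nlinarith [Real.exp_pos (-Real.pi * (n : ℝ) ^ 2 * x)]
  · have := Real.exp_pos (-Real.pi * ((1 : ℤ) : ℝ) ^ 2 * x)
    simp only [Int.natAbs_one, pow_one]
    linarith

/-! ### Doubling and inversion formulas -/

/-- A lattice sum supported on the pairs of equal parity, reparametrized by `(a + b, a - b)`. -/
theorem tsum_int_prod_eq_tsum_add_sub {f : ℤ × ℤ → ℝ}
    (hf : ∀ m n : ℤ, Odd (m + n) → f (m, n) = 0) :
    ∑' p, f p = ∑' p : ℤ × ℤ, f (p.1 + p.2, p.1 - p.2) := by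
  have hinj : Function.Injective fun p : ℤ × ℤ => (p.1 + p.2, p.1 - p.2) := by
    rintro ⟨a, b⟩ ⟨c, d⟩ h
    simp only [Prod.mk.injEq] at h ⊢
    omega
  refine (hinj.tsum_eq (f := f) ?_).symm
  rintro ⟨m, n⟩ hmn
  rcases Int.even_or_odd (m + n) with h | h
  · obtain ⟨a, ha⟩ := h
    exact ⟨(a, m - a), by ext <;> simp; omega⟩
  · exact absurd (hf m n h) hmn

theorem neg_one_pow_natAbs_mul_self (n : ℤ) : (-1 : ℝ) ^ n.natAbs * (-1) ^ n.natAbs = 1 := by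
  rw [← mul_pow]; simp

theorem neg_one_pow_natAbs_eq (n : ℤ) : (-1 : ℝ) ^ n.natAbs = (-1 : ℝ) ^ n := by
  rcases Int.even_or_odd n with h | h
  · rw [(Int.natAbs_even.2 h).neg_one_pow, h.neg_one_zpow]
  · rw [(Int.natAbs_odd.2 h).neg_one_pow, h.neg_one_zpow]

theorem neg_one_pow_natAbs_of_odd_add {m n : ℤ} (h : Odd (m + n)) :
    (-1 : ℝ) ^ m.natAbs = -(-1) ^ n.natAbs := by
  have h1 : (-1 : ℝ) ^ m * (-1) ^ n = -1 := by
    rw [← zpow_add₀ (by norm_num), h.neg_one_zpow]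
  have h2 := neg_one_pow_natAbs_mul_self n
  rw [neg_one_pow_natAbs_eq] at *
  rw [neg_one_pow_natAbs_eq] at *
  linear_combination (-1 : ℝ) ^ n * h1 - (-1 : ℝ) ^ m * h2

theorem exp_neg_pi_sq_mul_exp_neg_pi_sq (a b : ℤ) (x : ℝ) :
    Real.exp (-Real.pi * ((a + b : ℤ) : ℝ) ^ 2 * x) * Real.exp (-Real.pi * ((a - b : ℤ) : ℝ) ^ 2 * x)
      = Real.exp (-Real.pi * (a : ℝ) ^ 2 * (2 * x)) *
        Real.exp (-Real.pi * (b : ℝ) ^ 2 * (2 * x)) := by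
  rw [← Real.exp_add, ← Real.exp_add]
  congr 1
  push_cast
  ring

/-- On the right the pair (m, n) has weight 1 + (-1)^(m+n), which is twice the indicator of equal
parity; there m = a + b, n = a - b and m² + n² = 2(a² + b²). -/
theorem two_mul_thetaThree_two_mul_sq {x : ℝ} (hx : 0 < x) :
    2 * thetaThree (2 * x) ^ 2 = thetaThree x ^ 2 + thetaFour x ^ 2 := by
  have h3 := (summable_exp_neg_pi_sq hx).norm
  have h4 := (summable_alternating_exp_neg_pi_sq hx).norm
  have h2 := (summable_exp_neg_pi_sq (x := 2 * x) (by positivity)).norm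
  rw [sq, sq, sq, thetaThree_eq_tsum, thetaThree_eq_tsum, thetaFour_eq_tsum,
    tsum_mul_tsum_of_summable_norm h3 h3, tsum_mul_tsum_of_summable_norm h4 h4,
    tsum_mul_tsum_of_summable_norm h2 h2,
    ← (summable_mul_of_summable_norm h3 h3).tsum_add (summable_mul_of_summable_norm h4 h4),
    ← tsum_mul_left]
  symm
  rw [tsum_int_prod_eq_tsum_add_sub]
  · congr 1
    ext ⟨a, b⟩
    have e := exp_neg_pi_sq_mul_exp_neg_pi_sq a b x
    have s : (-1 : ℝ) ^ (a + b).natAbs = (-1) ^ (a - b).natAbs := by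
      rw [neg_one_pow_natAbs_eq, neg_one_pow_natAbs_eq, show a + b = (a - b) + 2 * b by ring,
        zpow_add₀ (by norm_num), (even_two_mul b).neg_one_zpow, mul_one]
    have q := neg_one_pow_natAbs_mul_self (a - b)
    simp only
    rw [s, ← e]
    linear_combination (Real.exp (-Real.pi * ((a + b : ℤ) : ℝ) ^ 2 * x) *
      Real.exp (-Real.pi * ((a - b : ℤ) : ℝ) ^ 2 * x)) * q
  · intro m n h
    have q := neg_one_pow_natAbs_mul_self n
    simp only
    rw [neg_one_pow_natAbs_of_odd_add h]
    linear_combination -(Real.exp (-Real.pi * (m : ℝ) ^ 2 * x) *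
      Real.exp (-Real.pi * (n : ℝ) ^ 2 * x)) * q

theorem thetaFour_two_mul_sq {x : ℝ} (hx : 0 < x) :
    thetaFour (2 * x) ^ 2 = thetaThree x * thetaFour x := by
  have h3 := (summable_exp_neg_pi_sq hx).norm
  have h4 := (summable_alternating_exp_neg_pi_sq hx).norm
  have h2 := (summable_alternating_exp_neg_pi_sq (x := 2 * x) (by positivity)).norm
  -- Symmetrizing the product makes the pairs of opposite parity cancel termwise.
  suffices h : 2 * (thetaFour (2 * x) * thetaFour (2 * x)) =
      thetaThree x * thetaFour x + thetaFour x * thetaThree x by linarith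
  rw [thetaThree_eq_tsum, thetaFour_eq_tsum, thetaFour_eq_tsum,
    tsum_mul_tsum_of_summable_norm h3 h4, tsum_mul_tsum_of_summable_norm h4 h3,
    tsum_mul_tsum_of_summable_norm h2 h2,
    ← (summable_mul_of_summable_norm h3 h4).tsum_add (summable_mul_of_summable_norm h4 h3),
    ← tsum_mul_left]
  symm
  rw [tsum_int_prod_eq_tsum_add_sub]
  · congr 1
    ext ⟨a, b⟩
    have e := exp_neg_pi_sq_mul_exp_neg_pi_sq a b x
    have s : (-1 : ℝ) ^ (a + b).natAbs = (-1) ^ a.natAbs * (-1) ^ b.natAbs := by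
      rw [neg_one_pow_natAbs_eq, neg_one_pow_natAbs_eq, neg_one_pow_natAbs_eq,
        zpow_add₀ (by norm_num)]
    have s' : (-1 : ℝ) ^ (a - b).natAbs = (-1) ^ a.natAbs * (-1) ^ b.natAbs := by
      rw [← s, neg_one_pow_natAbs_eq, neg_one_pow_natAbs_eq, show a + b = (a - b) + 2 * b by ring,
        zpow_add₀ (by norm_num), (even_two_mul b).neg_one_zpow, mul_one]
    simp only
    rw [s, s']
    linear_combination (2 * (-1 : ℝ) ^ a.natAbs * (-1) ^ b.natAbs) * e
  · intro m n h
    simp only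
    rw [neg_one_pow_natAbs_of_odd_add h]
    ring

theorem thetaThree_inv {x : ℝ} (hx : 0 < x) :
    thetaThree x⁻¹ = √x * thetaThree x := by
  have h := Real.tsum_exp_neg_mul_int_sq (a := x) hx
  rw [thetaThree_eq_tsum, thetaThree_eq_tsum]
  have e1 : (∑' n : ℤ, Real.exp (-Real.pi * (n : ℝ) ^ 2 * x)) =
      ∑' n : ℤ, Real.exp (-Real.pi * x * (n : ℝ) ^ 2) := by
    congr 1; ext n; congr 1; ring
  have e2 : (∑' n : ℤ, Real.exp (-Real.pi * (n : ℝ) ^ 2 * x⁻¹)) =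
      ∑' n : ℤ, Real.exp (-Real.pi / x * (n : ℝ) ^ 2) := by
    congr 1; ext n; congr 1; field_simp
  rw [e1, e2, h, Real.sqrt_eq_rpow]
  have : x ^ (1 / 2 : ℝ) ≠ 0 := (Real.rpow_pos_of_pos hx _).ne'
  field_simp

/-! ### Asymptotics at infinity -/

open Filter Topology

/-- The bound is uniform on a complex half-plane, not just on the real line, so that Cauchy's
estimate can pass it on to all derivatives. -/
theorem exists_norm_jacobiTheta3_sub_le :
    ∃ C : ℝ, 0 ≤ C ∧ ∀ z : ℂ, 1 ≤ z.re →
      ‖jacobiTheta3 z - (1 + 2 * Complex.exp (-Real.pi * z))‖ ≤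
        C * Real.exp (-2 * Real.pi * z.re) := by
  have hs : Summable fun n : ℕ => Real.exp (n * (-Real.pi)) :=
    Real.summable_exp_nat_mul_iff.2 (neg_neg_of_pos Real.pi_pos)
  refine ⟨2 * ∑' n : ℕ, Real.exp (n * (-Real.pi)), by positivity, fun z hz => ?_⟩
  have h := hasSum_nat_jacobiTheta (τ := Complex.I * z) (by simp; linarith)
  rw [← jacobiTheta3_eq_jacobiTheta] at h
  have h1 := (hasSum_nat_add_iff' 1).2 h
  have hb := h1.norm_le_of_bounded (hs.hasSum.mul_left (Real.exp (-2 * Real.pi * z.re)))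
    fun n => by
      have e : (Real.pi * Complex.I * (((n + 1 : ℕ) : ℂ) + 1) ^ 2 * (Complex.I * z))
          = ((-Real.pi * ((n : ℝ) + 2) ^ 2 : ℝ) : ℂ) * z := by
        push_cast
        linear_combination (Real.pi * ((n : ℂ) + 2) ^ 2 * z) * Complex.I_mul_I
      rw [e, Complex.norm_exp, Complex.re_ofReal_mul, ← Real.exp_add, Real.exp_le_exp]
      have hn : (0 : ℝ) ≤ n := n.cast_nonneg
      -- Of the exponent (n + 2)², the part 2 supplies the decay in Re z; since Re z ≥ 1, the rest
      -- dominates n and leaves a geometric series.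
      have h2 : 0 ≤ ((n : ℝ) + 2) ^ 2 - 2 := by nlinarith
      have h3 : (n : ℝ) ≤ (((n : ℝ) + 2) ^ 2 - 2) * z.re := by nlinarith
      nlinarith [mul_le_mul_of_nonneg_left h3 Real.pi_pos.le]
  have e : jacobiTheta3 z - (1 + 2 * Complex.exp (-Real.pi * z)) =
      2 * ((jacobiTheta3 z - 1) / 2 - ∑ i ∈ Finset.range 1,
        Complex.exp (Real.pi * Complex.I * ((i : ℂ) + 1) ^ 2 * (Complex.I * z))) := by
    have : (Real.pi * Complex.I * (0 + 1) ^ 2 * (Complex.I * z)) = -Real.pi * z := by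
      linear_combination (Real.pi * z) * Complex.I_mul_I
    simp only [Finset.sum_range_one, Nat.cast_zero, this]
    ring
  rw [e, norm_mul, Complex.norm_two]
  linarith

theorem iteratedDeriv_one_add_two_mul_exp (k : ℕ) :
    iteratedDeriv k (fun z : ℂ => 1 + 2 * Complex.exp (-Real.pi * z)) =
      fun z => (if k = 0 then 1 else 0) + 2 * (-Real.pi) ^ k * Complex.exp (-Real.pi * z) := by
  induction k with
  | zero => ext z; simp
  | succ k ih =>
    rw [iteratedDeriv_succ, ih]
    ext z
    have h1 : HasDerivAt (fun z : ℂ => -(Real.pi : ℂ) * z) (-(Real.pi : ℂ)) z := by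
      simpa using (hasDerivAt_id z).const_mul (-(Real.pi : ℂ))
    rw [((h1.cexp.const_mul (2 * (-(Real.pi : ℂ)) ^ k)).const_add (if k = 0 then (1 : ℂ) else 0)).deriv]
    simp
    ring

theorem contDiffAt_jacobiTheta3 (k : ℕ) {z : ℂ} (hz : 0 < z.re) :
    ContDiffAt ℂ k jacobiTheta3 z :=
  (differentiableOn_jacobiTheta3.contDiffOn isOpen_rightHalfPlane).contDiffAt
    (isOpen_rightHalfPlane.mem_nhds hz)

theorem tendsto_exp_mul_thetaLine {w : ℂ} (hw : w.re = 0) (k : ℕ) :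
    Tendsto (fun x : ℝ => Real.exp (Real.pi * x) * (thetaLine w k x - if k = 0 then 1 else 0))
      atTop (𝓝 (2 * (-Real.pi) ^ k * (Complex.exp (-Real.pi * w)).re)) := by
  obtain ⟨C, hC, hb⟩ := exists_norm_jacobiTheta3_sub_le
  set E : ℂ → ℂ := fun z => 1 + 2 * Complex.exp (-Real.pi * z) with hE
  have hEd : Differentiable ℂ E := by fun_prop
  -- For x ≥ 2 the closed unit disc about x + w stays in Re z ≥ 1, where the bound holds; its worst
  -- point has real part x - 1.
  have key : ∀ x : ℝ, 2 ≤ x →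
      ‖iteratedDeriv k jacobiTheta3 (x + w) - iteratedDeriv k E (x + w)‖ ≤
        k.factorial * (C * Real.exp (-2 * Real.pi * (x - 1))) / 1 ^ k := by
    intro x hx
    have hre : ((x : ℂ) + w).re = x := by simp [hw]
    rw [← iteratedDeriv_sub (contDiffAt_jacobiTheta3 k (by rw [hre]; linarith))
      hEd.contDiff.contDiffAt]
    have hball : ∀ z ∈ Metric.closedBall ((x : ℂ) + w) 1, x - 1 ≤ z.re := by
      intro z hz
      have h1 := (Complex.abs_re_le_norm (z - (x + w))).trans (mem_closedBall_iff_norm.1 hz)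
      rw [Complex.sub_re, hre, abs_le] at h1
      linarith [h1.1]
    refine Complex.norm_iteratedDeriv_le_of_forall_mem_sphere_norm_le k one_pos ?_ ?_
    · refine DifferentiableOn.diffContOnCl ?_
      rw [closure_ball _ one_ne_zero]
      intro z hz
      have hz' : 0 < z.re := by linarith [hball z hz]
      exact ((differentiableOn_jacobiTheta3.differentiableAt
        (isOpen_rightHalfPlane.mem_nhds hz')).sub (hEd z)).differentiableWithinAt
    · intro z hz
      have hz' := hball z (Metric.sphere_subset_closedBall hz)
      refine (hb z (by linarith)).trans (mul_le_mul_of_nonneg_left ?_ hC)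
      rw [Real.exp_le_exp]
      nlinarith [Real.pi_pos]
  rw [tendsto_iff_norm_sub_tendsto_zero]
  have hlim : Tendsto (fun x : ℝ => k.factorial * C * Real.exp (2 * Real.pi) *
      Real.exp (-(Real.pi * x))) atTop (𝓝 0) := by
    have h1 : Tendsto (fun x : ℝ => Real.exp (-(Real.pi * x))) atTop (𝓝 0) :=
      Real.tendsto_exp_neg_atTop_nhds_zero.comp (tendsto_id.const_mul_atTop Real.pi_pos)
    simpa using h1.const_mul (k.factorial * C * Real.exp (2 * Real.pi))
  refine squeeze_zero' (Eventually.of_forall fun x => norm_nonneg _) ?_ hlim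
  filter_upwards [eventually_ge_atTop 2] with x hx
  have e : Real.exp (Real.pi * x) * (thetaLine w k x - if k = 0 then 1 else 0) -
      2 * (-Real.pi) ^ k * (Complex.exp (-Real.pi * w)).re =
      Real.exp (Real.pi * x) *
        (iteratedDeriv k jacobiTheta3 (x + w) - iteratedDeriv k E (x + w)).re := by
    have e1 : Complex.exp (-Real.pi * (x + w)) =
        (Real.exp (-(Real.pi * x)) : ℂ) * Complex.exp (-Real.pi * w) := by
      rw [Complex.ofReal_exp, ← Complex.exp_add]
      congr 1
      push_cast
      ring
    have e2 : (2 * (-(Real.pi : ℂ)) ^ k * Complex.exp (-Real.pi * (x + w))).re =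
        2 * (-Real.pi) ^ k * Real.exp (-(Real.pi * x)) * (Complex.exp (-Real.pi * w)).re := by
      have : (2 * (-(Real.pi : ℂ)) ^ k * Complex.exp (-Real.pi * (x + w))) =
        ((2 * (-Real.pi) ^ k * Real.exp (-(Real.pi * x)) : ℝ) : ℂ) *
          Complex.exp (-Real.pi * w) := by
        rw [e1]; push_cast; ring
      rw [this, Complex.re_ofReal_mul]
    have e3 : ((if k = 0 then 1 else 0 : ℂ)).re = if k = 0 then 1 else 0 := by
      split_ifs <;> simp
    have e4 : Real.exp (Real.pi * x) * Real.exp (-(Real.pi * x)) = 1 := by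
      rw [← Real.exp_add]; simp
    rw [iteratedDeriv_one_add_two_mul_exp, Complex.sub_re, Complex.add_re, e2, e3, thetaLine]
    linear_combination (2 * (-Real.pi) ^ k * (Complex.exp (-Real.pi * w)).re) * e4
  rw [e, norm_mul, Real.norm_of_nonneg (Real.exp_pos _).le]
  refine (mul_le_mul_of_nonneg_left ((Complex.abs_re_le_norm _).trans (key x hx))
    (Real.exp_pos _).le).trans_eq ?_
  have e5 : Real.exp (Real.pi * x) * Real.exp (-2 * Real.pi * (x - 1)) =
      Real.exp (2 * Real.pi) * Real.exp (-(Real.pi * x)) := by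
    rw [← Real.exp_add, ← Real.exp_add]; congr 1; ring
  rw [one_pow, div_one]
  linear_combination (k.factorial * C) * e5

theorem tendsto_exp_mul_thetaThree_sub_one :
    Tendsto (fun x => Real.exp (Real.pi * x) * (thetaThree x - 1)) atTop (𝓝 2) := by
  simpa [thetaThree] using tendsto_exp_mul_thetaLine (w := 0) (by simp) 0

theorem tendsto_exp_mul_thetaLine_zero_succ (k : ℕ) :
    Tendsto (fun x => Real.exp (Real.pi * x) * thetaLine 0 (k + 1) x) atTop
      (𝓝 (2 * (-Real.pi) ^ (k + 1))) := by
  simpa using tendsto_exp_mul_thetaLine (w := 0) (by simp) (k + 1)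

theorem exp_neg_pi_mul_I : Complex.exp (-Real.pi * Complex.I) = -1 := by
  simp [Complex.exp_neg]

theorem tendsto_exp_mul_thetaFour_sub_one :
    Tendsto (fun x => Real.exp (Real.pi * x) * (thetaFour x - 1)) atTop (𝓝 (-2)) := by
  have := tendsto_exp_mul_thetaLine (w := Complex.I) (by simp) 0
  rw [exp_neg_pi_mul_I] at this
  simpa [thetaFour] using this

theorem tendsto_exp_mul_thetaLine_I_succ (k : ℕ) :
    Tendsto (fun x => Real.exp (Real.pi * x) * thetaLine Complex.I (k + 1) x) atTop
      (𝓝 (-(2 * (-Real.pi) ^ (k + 1)))) := by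
  have := tendsto_exp_mul_thetaLine (w := Complex.I) (by simp) (k + 1)
  rw [exp_neg_pi_mul_I] at this
  simpa using this

/-- Convergence at rate `exp (-π x)` beats any polynomial. -/
theorem tendsto_pow_mul_of_tendsto_exp_mul {f : ℝ → ℝ} {l : ℝ} (n : ℕ)
    (h : Tendsto (fun x => Real.exp (Real.pi * x) * f x) atTop (𝓝 l)) :
    Tendsto (fun x => x ^ n * f x) atTop (𝓝 0) := by
  have h1 : Tendsto (fun x : ℝ => x ^ n * Real.exp (-Real.pi * x)) atTop (𝓝 0) := by
    have h2 := (isLittleO_pow_exp_pos_mul_atTop (k := n) Real.pi_pos).tendsto_div_nhds_zero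
    refine h2.congr fun x => ?_
    rw [neg_mul, Real.exp_neg, div_eq_mul_inv]
  have h3 := h1.mul h
  rw [zero_mul] at h3
  refine h3.congr fun x => ?_
  have : Real.exp (-Real.pi * x) * Real.exp (Real.pi * x) = 1 := by
    rw [← Real.exp_add]; simp
  linear_combination (x ^ n * f x) * this

theorem tendsto_thetaThree_atTop : Tendsto thetaThree atTop (𝓝 1) := by
  have := tendsto_pow_mul_of_tendsto_exp_mul 0 tendsto_exp_mul_thetaThree_sub_one
  simpa using this.add_const 1

theorem tendsto_thetaFour_atTop : Tendsto thetaFour atTop (𝓝 1) := by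
  have := tendsto_pow_mul_of_tendsto_exp_mul 0 tendsto_exp_mul_thetaFour_sub_one
  simpa using this.add_const 1

/-! ### Propagation along x ↦ 2x -/

theorem tendsto_two_pow_mul_atTop {x : ℝ} (hx : 0 < x) :
    Tendsto (fun n : ℕ => (2 : ℝ) ^ n * x) atTop atTop :=
  (tendsto_pow_atTop_atTop_of_one_lt one_lt_two).atTop_mul_const hx

/-- Positivity holds near infinity and descends from 2x to x, because θ₃(x)θ₄(x) is the square of
θ₄(2x) and θ₃ > 0. -/
theorem thetaFour_pos {x : ℝ} (hx : 0 < x) : 0 < thetaFour x := by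
  obtain ⟨n, hn⟩ := ((tendsto_thetaFour_atTop.comp (tendsto_two_pow_mul_atTop hx)).eventually
    (lt_mem_nhds zero_lt_one)).exists
  have h : ∀ n : ℕ, ∀ y : ℝ, 0 < y → 0 < thetaFour (2 ^ n * y) → 0 < thetaFour y := by
    intro n
    induction n with
    | zero => intro y _ h; simpa using h
    | succ n ih =>
      intro y hy h
      have h2 : 0 < thetaFour (2 * y) :=
        ih (2 * y) (by positivity) (by rwa [← mul_assoc, ← pow_succ])
      have h3 := thetaFour_two_mul_sq hy
      exact pos_of_mul_pos_right (h3 ▸ pow_pos h2 2) (thetaThree_pos hy).le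
  exact h n x hx hn

/-- A function invariant under doubling equals its limit at infinity. -/
theorem eq_of_two_mul_eq_of_tendsto {f : ℝ → ℝ} {l : ℝ} (hf : ∀ x, 0 < x → f (2 * x) = f x)
    (hl : Tendsto f atTop (𝓝 l)) {x : ℝ} (hx : 0 < x) : f x = l := by
  have h : ∀ n : ℕ, f (2 ^ n * x) = f x := by
    intro n
    induction n with
    | zero => simp
    | succ n ih => rw [pow_succ', mul_assoc, hf _ (by positivity), ih]
  refine tendsto_nhds_unique ?_ (hl.comp (tendsto_two_pow_mul_atTop hx))
  exact tendsto_const_nhds.congr fun n => (h n).symm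

/-! ### Logarithmic derivatives and Jacobi's differential equation -/

/-- The logarithmic derivative of `θ₃`. -/
noncomputable def logDerivThree (x : ℝ) : ℝ := thetaLine 0 1 x / thetaThree x

/-- The logarithmic derivative of `θ₄`. -/
noncomputable def logDerivFour (x : ℝ) : ℝ := thetaLine Complex.I 1 x / thetaFour x

/-- The difference `θ₃⁴ - θ₄⁴`, which is `θ₂⁴`. -/
noncomputable def thetaTwoPowFour (x : ℝ) : ℝ := thetaThree x ^ 4 - thetaFour x ^ 4

theorem hasDerivAt_thetaThree_line {x : ℝ} (hx : 0 < x) :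
    HasDerivAt thetaThree (thetaLine 0 1 x) x :=
  hasDerivAt_thetaLine (by simp) 0 hx

theorem hasDerivAt_thetaFour_line {x : ℝ} (hx : 0 < x) :
    HasDerivAt thetaFour (thetaLine Complex.I 1 x) x :=
  hasDerivAt_thetaLine (by simp) 0 hx

theorem hasDerivAt_thetaThree {x : ℝ} (hx : 0 < x) :
    HasDerivAt thetaThree (logDerivThree x * thetaThree x) x := by
  rw [logDerivThree, div_mul_cancel₀ _ (thetaThree_pos hx).ne']
  exact hasDerivAt_thetaThree_line hx

theorem hasDerivAt_thetaFour {x : ℝ} (hx : 0 < x) :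
    HasDerivAt thetaFour (logDerivFour x * thetaFour x) x := by
  rw [logDerivFour, div_mul_cancel₀ _ (thetaFour_pos hx).ne']
  exact hasDerivAt_thetaFour_line hx

theorem hasDerivAt_logDerivFour {x : ℝ} (hx : 0 < x) :
    HasDerivAt logDerivFour (thetaLine Complex.I 2 x / thetaFour x - logDerivFour x ^ 2) x := by
  have h := (hasDerivAt_thetaLine (w := Complex.I) (by simp) 1 hx).div
    (hasDerivAt_thetaFour_line hx) (thetaFour_pos hx).ne'
  refine HasDerivAt.congr_deriv h ?_
  rw [logDerivFour]
  have := (thetaFour_pos hx).ne'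
  field_simp

theorem hasDerivAt_comp_two_mul {f : ℝ → ℝ} {f' x : ℝ} (h : HasDerivAt f f' (2 * x)) :
    HasDerivAt (fun y => f (2 * y)) (2 * f') x := by
  have := h.comp x ((hasDerivAt_id x).const_mul 2)
  exact this.congr_deriv (by ring)

theorem thetaTwoPowFour_pos {x : ℝ} (hx : 0 < x) : 0 < thetaTwoPowFour x :=
  sub_pos.2 (pow_lt_pow_left₀ (thetaFour_lt_thetaThree hx) (thetaFour_pos hx).le (by norm_num))

theorem thetaTwoPowFour_two_mul {x : ℝ} (hx : 0 < x) :
    4 * thetaTwoPowFour (2 * x) = (thetaThree x ^ 2 - thetaFour x ^ 2) ^ 2 := by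
  have h3 := two_mul_thetaThree_two_mul_sq hx
  have h4 := thetaFour_two_mul_sq hx
  rw [thetaTwoPowFour]
  linear_combination (2 * thetaThree (2 * x) ^ 2 + (thetaThree x ^ 2 + thetaFour x ^ 2)) * h3 -
    4 * (thetaFour (2 * x) ^ 2 + thetaThree x * thetaFour x) * h4

theorem four_mul_logDerivFour_two_mul {x : ℝ} (hx : 0 < x) :
    4 * logDerivFour (2 * x) = logDerivThree x + logDerivFour x := by
  have hx2 : 0 < 2 * x := by positivity
  have h1 := (hasDerivAt_comp_two_mul (hasDerivAt_thetaFour hx2)).pow 2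
  have h2 := (hasDerivAt_thetaThree hx).mul (hasDerivAt_thetaFour hx)
  have h3 : (fun y => thetaFour (2 * y)) ^ 2 =ᶠ[𝓝 x] thetaThree * thetaFour := by
    filter_upwards [lt_mem_nhds hx] with y hy
    exact thetaFour_two_mul_sq hy
  have h := (h1.congr_of_eventuallyEq h3.symm).unique h2
  have e := thetaFour_two_mul_sq hx
  have hp : thetaThree x * thetaFour x ≠ 0 :=
    (mul_pos (thetaThree_pos hx) (thetaFour_pos hx)).ne'
  refine mul_right_cancel₀ hp ?_
  norm_num at h
  linear_combination h - 4 * logDerivFour (2 * x) * e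

theorem two_mul_logDerivThree_two_mul {x : ℝ} (hx : 0 < x) :
    2 * (thetaThree x ^ 2 + thetaFour x ^ 2) * logDerivThree (2 * x) =
      thetaThree x ^ 2 * logDerivThree x + thetaFour x ^ 2 * logDerivFour x := by
  have hx2 : 0 < 2 * x := by positivity
  have h1 := ((hasDerivAt_comp_two_mul (hasDerivAt_thetaThree hx2)).pow 2).const_mul 2
  have h2 := ((hasDerivAt_thetaThree hx).pow 2).add ((hasDerivAt_thetaFour hx).pow 2)
  have h3 : (fun y => 2 * ((fun y => thetaThree (2 * y)) ^ 2) y) =ᶠ[𝓝 x]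
      thetaThree ^ 2 + thetaFour ^ 2 := by
    filter_upwards [lt_mem_nhds hx] with y hy
    exact two_mul_thetaThree_two_mul_sq hy
  have h := (h1.congr_of_eventuallyEq h3.symm).unique h2
  have e := two_mul_thetaThree_two_mul_sq hx
  norm_num at h
  linear_combination h / 2 - 2 * logDerivThree (2 * x) * e

/-- Differentiating the doubling formulas shows that numerator and denominator both scale by (θ₃² -
θ₄²)/(4(θ₃² + θ₄²)). -/
theorem logDerivThree_sub_logDerivFour_div_two_mul {x : ℝ} (hx : 0 < x) :
    (logDerivThree (2 * x) - logDerivFour (2 * x)) / thetaTwoPowFour (2 * x) =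
      (logDerivThree x - logDerivFour x) / thetaTwoPowFour x := by
  have h3 := two_mul_logDerivThree_two_mul hx
  have h4 := four_mul_logDerivFour_two_mul hx
  have hB := thetaTwoPowFour_two_mul hx
  have hx2 : 0 < 2 * x := by positivity
  have h3p := thetaThree_pos hx
  have h4p := thetaFour_pos hx
  have hs : 4 * (thetaThree x ^ 2 + thetaFour x ^ 2) ≠ 0 := by positivity
  rw [div_eq_div_iff (thetaTwoPowFour_pos hx2).ne' (thetaTwoPowFour_pos hx).ne']
  refine mul_left_cancel₀ hs ?_
  have e : thetaTwoPowFour x = (thetaThree x ^ 2 - thetaFour x ^ 2) *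
    (thetaThree x ^ 2 + thetaFour x ^ 2) := by rw [thetaTwoPowFour]; ring
  linear_combination (2 * h3 - (thetaThree x ^ 2 + thetaFour x ^ 2) * h4) * thetaTwoPowFour x
    - (logDerivThree x - logDerivFour x) * (thetaThree x ^ 2 + thetaFour x ^ 2) * hB
    + (logDerivThree x - logDerivFour x) * (thetaThree x ^ 2 - thetaFour x ^ 2) * e

theorem logDerivThree_sub_logDerivFour {x : ℝ} (hx : 0 < x) :
    logDerivThree x - logDerivFour x = -(Real.pi / 4) * thetaTwoPowFour x := by
  suffices h : (logDerivThree x - logDerivFour x) / thetaTwoPowFour x = -(Real.pi / 4) by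
    rwa [div_eq_iff (thetaTwoPowFour_pos hx).ne'] at h
  refine eq_of_two_mul_eq_of_tendsto (f := fun x => (logDerivThree x - logDerivFour x) /
    thetaTwoPowFour x) (fun x hx => logDerivThree_sub_logDerivFour_div_two_mul hx) ?_ hx
  have t3 := tendsto_thetaThree_atTop
  have t4 := tendsto_thetaFour_atTop
  have hn := ((tendsto_exp_mul_thetaLine_zero_succ 0).div t3 one_ne_zero).sub
    ((tendsto_exp_mul_thetaLine_I_succ 0).div t4 one_ne_zero)
  have hd := ((tendsto_exp_mul_thetaThree_sub_one.sub tendsto_exp_mul_thetaFour_sub_one).mul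
    (t3.add t4)).mul ((t3.pow 2).add (t4.pow 2))
  have h := hn.div hd (by norm_num)
  -- After multiplication by exp(πx), the numerator tends to -4π and the denominator to 16.
  have e : (2 * (-Real.pi) ^ (0 + 1) / 1 - -(2 * (-Real.pi) ^ (0 + 1)) / 1) /
      ((2 - -2) * (1 + 1) * (1 ^ 2 + 1 ^ 2)) = -(Real.pi / 4) := by ring
  rw [e] at h
  refine h.congr fun y => ?_
  have hE := (Real.exp_pos (Real.pi * y)).ne'
  simp only [Pi.div_apply]
  rw [← mul_div_mul_left _ (thetaTwoPowFour y) hE, logDerivThree, logDerivFour, thetaTwoPowFour]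
  congr 1 <;> ring

theorem hasDerivAt_thetaTwoPowFour {x : ℝ} (hx : 0 < x) :
    HasDerivAt thetaTwoPowFour
      (thetaTwoPowFour x * (4 * logDerivThree x - Real.pi * thetaFour x ^ 4)) x := by
  have h := ((hasDerivAt_thetaThree hx).pow 4).sub ((hasDerivAt_thetaFour hx).pow 4)
  refine HasDerivAt.congr_deriv h ?_
  have e := logDerivThree_sub_logDerivFour hx
  norm_num
  have e2 : thetaTwoPowFour x = thetaThree x ^ 4 - thetaFour x ^ 4 := rfl
  linear_combination (4 * thetaFour x ^ 4) * e - 4 * logDerivThree x * e2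

/-- The defect in the second-order differential equation of `θ₄`. -/
noncomputable def thetaFourDefect (x : ℝ) : ℝ :=
  thetaLine Complex.I 2 x / thetaFour x - 3 * logDerivFour x ^ 2 +
    Real.pi ^ 2 / 8 * thetaTwoPowFour x * thetaThree x ^ 4

theorem hasDerivAt_logDerivFour_defect {x : ℝ} (hx : 0 < x) :
    HasDerivAt logDerivFour (thetaFourDefect x + 2 * logDerivFour x ^ 2 -
      Real.pi ^ 2 / 8 * thetaTwoPowFour x * thetaThree x ^ 4) x := by
  refine (hasDerivAt_logDerivFour hx).congr_deriv ?_
  rw [thetaFourDefect]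
  ring

/-- The known difference L₃ - L₄ forces the same defect to occur in both Riccati equations, so one
scalar function controls the two. -/
theorem hasDerivAt_logDerivThree_defect {x : ℝ} (hx : 0 < x) :
    HasDerivAt logDerivThree (thetaFourDefect x + 2 * logDerivThree x ^ 2 +
      Real.pi ^ 2 / 8 * thetaTwoPowFour x * thetaFour x ^ 4) x := by
  have h := (hasDerivAt_logDerivFour_defect hx).add
    ((hasDerivAt_thetaTwoPowFour hx).const_mul (-(Real.pi / 4)))
  have h3 : logDerivThree =ᶠ[𝓝 x]
      logDerivFour + fun y => -(Real.pi / 4) * thetaTwoPowFour y := by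
    filter_upwards [lt_mem_nhds hx] with y hy
    simp only [Pi.add_apply]
    linear_combination logDerivThree_sub_logDerivFour hy
  refine (h.congr_of_eventuallyEq h3).congr_deriv ?_
  have e := logDerivThree_sub_logDerivFour hx
  have e2 : thetaTwoPowFour x = thetaThree x ^ 4 - thetaFour x ^ 4 := rfl
  have e3 : logDerivFour x = logDerivThree x + Real.pi / 4 * thetaTwoPowFour x := by linarith
  rw [e3, e2]
  ring

/-- Differentiating 4L₄(2x) = L₃(x) + L₄(x) leaves 8D(2x) = 2D(x) for the defect D, as all other
terms cancel by the doubling formulas. -/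
theorem four_mul_thetaFourDefect_two_mul {x : ℝ} (hx : 0 < x) :
    4 * thetaFourDefect (2 * x) = thetaFourDefect x := by
  have hx2 : 0 < 2 * x := by positivity
  have h1 := (hasDerivAt_comp_two_mul (hasDerivAt_logDerivFour_defect hx2)).const_mul 4
  have h2 := (hasDerivAt_logDerivThree_defect hx).add (hasDerivAt_logDerivFour_defect hx)
  have h3 : (fun y => 4 * logDerivFour (2 * y)) =ᶠ[𝓝 x] logDerivThree + logDerivFour := by
    filter_upwards [lt_mem_nhds hx] with y hy
    exact four_mul_logDerivFour_two_mul hy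
  have h := (h1.congr_of_eventuallyEq h3.symm).unique h2
  have e := logDerivThree_sub_logDerivFour hx
  have e2 : thetaTwoPowFour x = thetaThree x ^ 4 - thetaFour x ^ 4 := rfl
  have e4 : logDerivFour x = logDerivThree x + Real.pi / 4 * thetaTwoPowFour x := by linarith
  have e5 : logDerivFour (2 * x) = (logDerivThree x + logDerivFour x) / 4 := by
    linarith [four_mul_logDerivFour_two_mul hx]
  have e6 : thetaTwoPowFour (2 * x) = (thetaThree x ^ 2 - thetaFour x ^ 2) ^ 2 / 4 := by
    linarith [thetaTwoPowFour_two_mul hx]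
  have e7 : thetaThree (2 * x) ^ 4 = (thetaThree x ^ 2 + thetaFour x ^ 2) ^ 2 / 4 := by
    have := two_mul_thetaThree_two_mul_sq hx
    rw [← this]; ring
  rw [e5, e6, e7, e4, e2] at h
  linear_combination h / 2

theorem thetaFourDefect_eq_zero {x : ℝ} (hx : 0 < x) : thetaFourDefect x = 0 := by
  suffices h : x ^ 2 * thetaFourDefect x = 0 from
    (mul_eq_zero.1 h).resolve_left (by positivity)
  -- The factor x² absorbs the 4 and makes the function invariant; exponential decay still sends it
  -- to 0.
  refine eq_of_two_mul_eq_of_tendsto (f := fun x => x ^ 2 * thetaFourDefect x) (fun y hy => ?_) ?_ hx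
  · linear_combination y ^ 2 * four_mul_thetaFourDefect_two_mul hy
  have t3 := tendsto_thetaThree_atTop
  have t4 := tendsto_thetaFour_atTop
  have a1 := tendsto_pow_mul_of_tendsto_exp_mul 1 (tendsto_exp_mul_thetaLine_I_succ 0)
  have a2 := tendsto_pow_mul_of_tendsto_exp_mul 2 (tendsto_exp_mul_thetaLine_I_succ 1)
  have b := (((tendsto_pow_mul_of_tendsto_exp_mul 2 tendsto_exp_mul_thetaThree_sub_one).sub
    (tendsto_pow_mul_of_tendsto_exp_mul 2 tendsto_exp_mul_thetaFour_sub_one)).mul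
    (t3.add t4)).mul ((t3.pow 2).add (t4.pow 2))
  have h := ((a2.div t4 one_ne_zero).sub (((a1.div t4 one_ne_zero).pow 2).const_mul 3)).add
    ((b.mul (t3.pow 4)).const_mul (Real.pi ^ 2 / 8))
  have e : (0 : ℝ) / 1 - 3 * (0 / 1) ^ 2 +
      Real.pi ^ 2 / 8 * ((0 - 0) * (1 + 1) * (1 ^ 2 + 1 ^ 2) * 1 ^ 4) = 0 := by norm_num
  rw [e] at h
  refine h.congr fun y => ?_
  simp only [Pi.div_apply]
  rw [thetaFourDefect, logDerivFour, thetaTwoPowFour]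
  ring

/-- Jacobi's differential equation for `θ₃`. -/
theorem hasDerivAt_logDerivThree {x : ℝ} (hx : 0 < x) :
    HasDerivAt logDerivThree (2 * logDerivThree x ^ 2 +
      Real.pi ^ 2 / 8 * thetaTwoPowFour x * thetaFour x ^ 4) x := by
  simpa [thetaFourDefect_eq_zero hx] using hasDerivAt_logDerivThree_defect hx

/-! ### Values at the fixed point 1 -/

/-- Doubling at 1/2 and at 1 links the arguments 1/2, 1, 2, and the inversion formula at 2 closes
the chain; no inversion formula for θ₄ is needed. -/
theorem thetaThree_one_pow_four : thetaThree 1 ^ 4 = 2 * thetaFour 1 ^ 4 := by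
  have h1 := two_mul_thetaThree_two_mul_sq (x := 1) one_pos
  have h2 := two_mul_thetaThree_two_mul_sq (x := 1 / 2) (by norm_num)
  have h3 := thetaFour_two_mul_sq (x := 1 / 2) (by norm_num)
  have h4 := thetaThree_inv (x := 2) (by norm_num)
  norm_num at h1 h2 h3 h4
  have h5 : thetaThree (1 / 2) ^ 2 = 2 * thetaThree 2 ^ 2 := by
    rw [h4, mul_pow, Real.sq_sqrt (by norm_num)]
  have h6 : thetaFour (1 / 2) ^ 2 = thetaThree 1 ^ 2 - thetaFour 1 ^ 2 := by linarith
  have h7 : thetaFour 1 ^ 4 = thetaThree (1 / 2) ^ 2 * thetaFour (1 / 2) ^ 2 := by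
    rw [← mul_pow, ← h3]; ring
  rw [h6, h5, h1] at h7
  linear_combination -h7

/-- Differentiating the inversion formula at 1 gives -L₃(1) = 1/2 + L₃(1). -/
theorem logDerivThree_one : logDerivThree 1 = -1 / 4 := by
  have h1 : HasDerivAt (fun x : ℝ => thetaThree x⁻¹) (-(logDerivThree 1 * thetaThree 1)) 1 := by
    have h := hasDerivAt_inv (one_ne_zero (α := ℝ))
    have h0 : HasDerivAt thetaThree (logDerivThree 1 * thetaThree 1) (1 : ℝ)⁻¹ := by
      simpa using hasDerivAt_thetaThree one_pos
    exact (h0.comp 1 h).congr_deriv (by simp)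
  have h2 : HasDerivAt (fun x : ℝ => √x * thetaThree x)
      (1 / 2 * thetaThree 1 + logDerivThree 1 * thetaThree 1) 1 := by
    exact ((Real.hasDerivAt_sqrt one_ne_zero).mul (hasDerivAt_thetaThree one_pos)).congr_deriv
      (by simp)
  have h3 : (fun x : ℝ => thetaThree x⁻¹) =ᶠ[𝓝 1] fun x => √x * thetaThree x := by
    filter_upwards [lt_mem_nhds one_pos] with y hy
    exact thetaThree_inv hy
  have h := (h1.congr_of_eventuallyEq h3.symm).unique h2
  have hp := (thetaThree_pos one_pos).ne'
  refine mul_right_cancel₀ hp ?_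
  linear_combination -h / 2

/-! ### Gauss' elliptic integral and the arithmetic-geometric mean -/

open MeasureTheory Set

theorem integral_eq_integral_Ioi_sub_div {m : ℝ} (hm : 0 < m) (g : ℝ → ℝ) :
    ∫ u, g u = ∫ t in Ioi (0 : ℝ), (1 + m / t ^ 2) / 2 * g ((t - m / t) / 2) := by
  have himg : (fun t : ℝ => (t - m / t) / 2) '' Ioi 0 = univ := by
    -- The preimage of u is the positive root of t² - 2ut - m = 0.
    refine eq_univ_of_forall fun u => ⟨u + √(u ^ 2 + m), ?_, ?_⟩
    · have : -u < √(u ^ 2 + m) := Real.lt_sqrt_of_sq_lt (by nlinarith)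
      simp only [mem_Ioi]
      linarith
    · have h1 : -u < √(u ^ 2 + m) := Real.lt_sqrt_of_sq_lt (by nlinarith)
      have h2 : √(u ^ 2 + m) ^ 2 = u ^ 2 + m := Real.sq_sqrt (by positivity)
      have h3 : u + √(u ^ 2 + m) ≠ 0 := by linarith
      simp only
      field_simp
      linear_combination h2
  have hderiv : ∀ t ∈ Ioi (0 : ℝ), HasDerivWithinAt (fun t : ℝ => (t - m / t) / 2)
      ((1 + m / t ^ 2) / 2) (Ioi 0) t := by
    intro t ht
    have ht' : t ≠ 0 := (mem_Ioi.1 ht).ne'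
    have h := ((hasDerivAt_id t).sub ((hasDerivAt_const t m).div (hasDerivAt_id t) ht')).div_const 2
    refine (HasDerivAt.congr_deriv h ?_).hasDerivWithinAt
    simp only [id]
    ring
  have hinj : InjOn (fun t : ℝ => (t - m / t) / 2) (Ioi 0) := by
    intro s hs t ht h
    have hs' : 0 < s := hs
    have ht' : 0 < t := ht
    simp only at h
    field_simp at h
    have h2 : (s - t) * (s * t + m) = 0 := by linear_combination h
    rcases mul_eq_zero.1 h2 with h3 | h3
    · linarith
    · nlinarith [mul_pos hs' ht']
  have h := integral_image_eq_integral_abs_deriv_smul measurableSet_Ioi hderiv hinj g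
  rw [himg, setIntegral_univ] at h
  rw [h]
  refine setIntegral_congr_fun measurableSet_Ioi fun t ht => ?_
  have ht' : 0 < t := ht
  simp only [smul_eq_mul]
  rw [abs_of_pos (by positivity)]

/-- Gauss' complete elliptic integral `∫ dt / √((t² + a²)(t² + b²))` over the real line. -/
noncomputable def gaussIntegral (a b : ℝ) : ℝ :=
  ∫ t : ℝ, 1 / √((t ^ 2 + a ^ 2) * (t ^ 2 + b ^ 2))

/-- Substitute u = (t - ab/t)/2: then u² + ab = ((t + ab/t)/2)² is cancelled by the Jacobian, up to
a factor, and u² + c² = (t² + a²)(t² + b²)/(4t²). -/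
theorem gaussIntegral_mean {a b c d : ℝ} (ha : 0 < a) (hb : 0 < b)
    (hc : 2 * c = a + b) (hd : d ^ 2 = a * b) : gaussIntegral c d = gaussIntegral a b := by
  have hm : 0 < a * b := mul_pos ha hb
  have h2 : gaussIntegral a b =
      2 * ∫ t in Ioi (0 : ℝ), 1 / √((t ^ 2 + a ^ 2) * (t ^ 2 + b ^ 2)) := by
    rw [← integral_comp_abs (f := fun t : ℝ => 1 / √((t ^ 2 + a ^ 2) * (t ^ 2 + b ^ 2)))]
    simp only [sq_abs, gaussIntegral]
  rw [h2, gaussIntegral, integral_eq_integral_Ioi_sub_div hm, ← integral_const_mul]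
  refine setIntegral_congr_fun measurableSet_Ioi fun t ht => ?_
  have ht' : 0 < t := ht
  have hP : 0 < (t ^ 2 + a ^ 2) * (t ^ 2 + b ^ 2) := by positivity
  have e : (((t - a * b / t) / 2) ^ 2 + c ^ 2) * (((t - a * b / t) / 2) ^ 2 + d ^ 2) =
      ((t ^ 2 + a ^ 2) * (t ^ 2 + b ^ 2)) * ((t ^ 2 + a * b) / (4 * t ^ 2)) ^ 2 := by
    rw [hd, show c = (a + b) / 2 by linarith]
    field_simp
    ring
  rw [e, Real.sqrt_mul hP.le, Real.sqrt_sq (by positivity)]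
  have hs : √((t ^ 2 + a ^ 2) * (t ^ 2 + b ^ 2)) ≠ 0 := (Real.sqrt_pos.2 hP).ne'
  field_simp
  ring

theorem integrable_inv_sq_add_sq {m : ℝ} (hm : 0 < m) :
    Integrable fun t : ℝ => 1 / (t ^ 2 + m ^ 2) := by
  have h := (integrable_inv_one_add_sq.comp_div hm.ne').const_mul (1 / m ^ 2)
  refine h.congr (Eventually.of_forall fun t => ?_)
  simp only
  field_simp
  ring

theorem integral_inv_sq_add_sq_univ {m : ℝ} (hm : 0 < m) :
    ∫ t : ℝ, 1 / (t ^ 2 + m ^ 2) = Real.pi / m := by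
  have e : ∀ t : ℝ, 1 / (t ^ 2 + m ^ 2) = 1 / m ^ 2 * (1 + (t / m) ^ 2)⁻¹ := fun t => by
    field_simp
    ring
  simp_rw [e]
  rw [integral_const_mul, Measure.integral_comp_div (fun t : ℝ => (1 + t ^ 2)⁻¹),
    integral_univ_inv_one_add_sq, abs_of_pos hm, smul_eq_mul]
  field_simp

theorem continuous_gaussIntegrand {a b : ℝ} (ha : 0 < a) (hb : 0 < b) :
    Continuous fun t : ℝ => 1 / √((t ^ 2 + a ^ 2) * (t ^ 2 + b ^ 2)) := by
  refine continuous_const.div (by fun_prop) fun t => (Real.sqrt_pos.2 (by positivity)).ne'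

theorem gaussIntegrand_le {a b m t : ℝ} (hm : 0 < m) (ha : m ≤ a) (hb : m ≤ b) :
    1 / √((t ^ 2 + a ^ 2) * (t ^ 2 + b ^ 2)) ≤ 1 / (t ^ 2 + m ^ 2) := by
  refine one_div_le_one_div_of_le (by positivity) (Real.le_sqrt_of_sq_le ?_)
  rw [sq (t ^ 2 + m ^ 2)]
  gcongr

theorem le_gaussIntegrand {a b M t : ℝ} (ha0 : 0 < a) (hb0 : 0 < b) (ha : a ≤ M) (hb : b ≤ M) :
    1 / (t ^ 2 + M ^ 2) ≤ 1 / √((t ^ 2 + a ^ 2) * (t ^ 2 + b ^ 2)) := by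
  refine one_div_le_one_div_of_le (Real.sqrt_pos.2 (by positivity)) (Real.sqrt_le_iff.2 ⟨?_, ?_⟩)
  · positivity
  · rw [sq (t ^ 2 + M ^ 2)]
    gcongr

theorem integrable_gaussIntegrand {a b : ℝ} (ha : 0 < a) (hb : 0 < b) :
    Integrable fun t : ℝ => 1 / √((t ^ 2 + a ^ 2) * (t ^ 2 + b ^ 2)) := by
  refine (integrable_inv_sq_add_sq (lt_min ha hb)).mono'
    (continuous_gaussIntegrand ha hb).aestronglyMeasurable (Eventually.of_forall fun t => ?_)
  rw [Real.norm_of_nonneg (by positivity)]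
  exact gaussIntegrand_le (lt_min ha hb) (min_le_left _ _) (min_le_right _ _)

theorem gaussIntegral_le {a b m : ℝ} (hm : 0 < m) (ha : m ≤ a) (hb : m ≤ b) :
    gaussIntegral a b ≤ Real.pi / m := by
  rw [← integral_inv_sq_add_sq_univ hm]
  exact integral_mono (integrable_gaussIntegrand (hm.trans_le ha) (hm.trans_le hb))
    (integrable_inv_sq_add_sq hm) fun t => gaussIntegrand_le hm ha hb

theorem le_gaussIntegral {a b M : ℝ} (ha0 : 0 < a) (hb0 : 0 < b) (ha : a ≤ M) (hb : b ≤ M) :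
    Real.pi / M ≤ gaussIntegral a b := by
  rw [← integral_inv_sq_add_sq_univ (ha0.trans_le ha)]
  exact integral_mono (integrable_inv_sq_add_sq (ha0.trans_le ha))
    (integrable_gaussIntegrand ha0 hb0) fun t => le_gaussIntegrand ha0 hb0 ha hb

/-- Gauss' evaluation of the complete elliptic integral by theta constants. -/
theorem gaussIntegral_thetaThree_sq_thetaFour_sq {x : ℝ} (hx : 0 < x) :
    gaussIntegral (thetaThree x ^ 2) (thetaFour x ^ 2) = Real.pi := by
  refine eq_of_two_mul_eq_of_tendsto
    (f := fun x => gaussIntegral (thetaThree x ^ 2) (thetaFour x ^ 2)) (fun y hy => ?_) ?_ hx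
  · refine gaussIntegral_mean (pow_pos (thetaThree_pos hy) 2) (pow_pos (thetaFour_pos hy) 2)
      (two_mul_thetaThree_two_mul_sq hy) ?_
    rw [thetaFour_two_mul_sq hy, mul_pow]
  -- The integral is squeezed between π/θ₃² and π/θ₄², both tending to π.
  · have l3 := tendsto_const_nhds (x := Real.pi) |>.div (tendsto_thetaThree_atTop.pow 2) (by norm_num)
    have l4 := tendsto_const_nhds (x := Real.pi) |>.div (tendsto_thetaFour_atTop.pow 2) (by norm_num)
    rw [one_pow, div_one] at l3 l4
    refine tendsto_of_tendsto_of_tendsto_of_le_of_le' l3 l4 ?_ ?_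
    all_goals
      filter_upwards [eventually_gt_atTop 0] with y hy
      have h3 := thetaThree_pos hy
      have h4 := thetaFour_pos hy
      have h : thetaFour y ^ 2 ≤ thetaThree y ^ 2 :=
        pow_le_pow_left₀ h4.le (thetaFour_lt_thetaThree hy).le 2
    · exact le_gaussIntegral (by positivity) (by positivity) le_rfl h
    · exact gaussIntegral_le (by positivity) h le_rfl

/-! ### The lemniscatic integral and Γ(1/4) -/

theorem integral_Ioo_rpow_mul_rpow_quarter :
    ∫ y in Ioo (0 : ℝ) 1, y ^ (-3 / 4 : ℝ) * (1 - y) ^ (-3 / 4 : ℝ) =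
      Real.Gamma (1 / 4) ^ 2 / √Real.pi := by
  have h1 : Complex.betaIntegral ((1 / 4 : ℝ) : ℂ) ((1 / 4 : ℝ) : ℂ) =
      ((∫ y in Ioo (0 : ℝ) 1, y ^ (-3 / 4 : ℝ) * (1 - y) ^ (-3 / 4 : ℝ) : ℝ) : ℂ) := by
    rw [Complex.betaIntegral, intervalIntegral.integral_of_le zero_le_one,
      integral_Ioc_eq_integral_Ioo, ← integral_complex_ofReal]
    refine setIntegral_congr_fun measurableSet_Ioo fun y hy => ?_
    have e : ((1 / 4 : ℝ) : ℂ) - 1 = ((-3 / 4 : ℝ) : ℂ) := by push_cast; norm_num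
    rw [e, Complex.ofReal_mul, Complex.ofReal_cpow hy.1.le,
      Complex.ofReal_cpow (by linarith [hy.2])]
    push_cast
    rfl
  have h2 := ProbabilityTheory.beta_eq_betaIntegralReal (1 / 4) (1 / 4) (by norm_num) (by norm_num)
  rw [h1, Complex.ofReal_re, ProbabilityTheory.beta] at h2
  rw [← h2, ← Real.Gamma_one_half_eq]
  norm_num
  ring

/-- The substitution y = t⁴/(1 + t⁴) turns the Beta integral B(1/4, 1/4) into four times this one.
-/
theorem integral_Ioi_inv_sqrt_one_add_pow_four :
    ∫ t in Ioi (0 : ℝ), 1 / √(t ^ 4 + 1) = Real.Gamma (1 / 4) ^ 2 / (4 * √Real.pi) := by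
  have himg : (fun t : ℝ => t ^ 4 / (1 + t ^ 4)) '' Ioi 0 = Ioo 0 1 := by
    ext y
    constructor
    · rintro ⟨t, ht, rfl⟩
      have ht' : 0 < t := ht
      refine ⟨by positivity, ?_⟩
      rw [div_lt_one (by positivity)]
      linarith
    · rintro ⟨h0, h1⟩
      have hpos : 0 < y / (1 - y) := div_pos h0 (by linarith)
      refine ⟨(y / (1 - y)) ^ (1 / 4 : ℝ), Real.rpow_pos_of_pos hpos _, ?_⟩
      have e : ((y / (1 - y)) ^ (1 / 4 : ℝ)) ^ 4 = y / (1 - y) := by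
        rw [← Real.rpow_natCast, ← Real.rpow_mul hpos.le]
        norm_num
      simp only
      rw [e]
      have : 1 - y ≠ 0 := by linarith
      field_simp
      ring
  have hderiv : ∀ t ∈ Ioi (0 : ℝ), HasDerivWithinAt (fun t : ℝ => t ^ 4 / (1 + t ^ 4))
      (4 * t ^ 3 / (1 + t ^ 4) ^ 2) (Ioi 0) t := by
    intro t ht
    have h := (hasDerivAt_pow 4 t).div ((hasDerivAt_pow 4 t).const_add 1)
      (by positivity : (1 + t ^ 4 : ℝ) ≠ 0)
    refine (HasDerivAt.congr_deriv h ?_).hasDerivWithinAt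
    norm_num
    ring
  have hinj : InjOn (fun t : ℝ => t ^ 4 / (1 + t ^ 4)) (Ioi 0) := by
    intro s hs t ht h
    simp only at h
    rw [div_eq_div_iff (by positivity) (by positivity)] at h
    exact (pow_left_inj₀ (le_of_lt hs) (le_of_lt ht) (by norm_num : 4 ≠ 0)).1 (by linarith)
  have h := integral_image_eq_integral_abs_deriv_smul measurableSet_Ioi hderiv hinj
    fun y => y ^ (-3 / 4 : ℝ) * (1 - y) ^ (-3 / 4 : ℝ)
  rw [himg, integral_Ioo_rpow_mul_rpow_quarter] at h
  have h2 : ∫ t in Ioi (0 : ℝ), |4 * t ^ 3 / (1 + t ^ 4) ^ 2| •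
      ((t ^ 4 / (1 + t ^ 4)) ^ (-3 / 4 : ℝ) * (1 - t ^ 4 / (1 + t ^ 4)) ^ (-3 / 4 : ℝ)) =
      4 * ∫ t in Ioi (0 : ℝ), 1 / √(t ^ 4 + 1) := by
    rw [← integral_const_mul]
    refine setIntegral_congr_fun measurableSet_Ioi fun t ht => ?_
    have ht' : 0 < t := ht
    have hq : 0 < 1 + t ^ 4 := by positivity
    have e1 : 1 - t ^ 4 / (1 + t ^ 4) = 1 / (1 + t ^ 4) := by field_simp; ring
    have e2 : t ^ 4 / (1 + t ^ 4) * (1 / (1 + t ^ 4)) = (t ^ 2 / (1 + t ^ 4)) ^ 2 := by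
      field_simp
    have e3 : ((t ^ 2 / (1 + t ^ 4)) ^ 2) ^ (-3 / 4 : ℝ) = (√(t ^ 2 / (1 + t ^ 4)) ^ 3)⁻¹ := by
      rw [← Real.rpow_natCast (_ / _) 2, ← Real.rpow_mul (by positivity), Real.sqrt_eq_rpow,
        ← Real.rpow_natCast (_ ^ _) 3, ← Real.rpow_mul (by positivity), ← Real.rpow_neg
        (by positivity)]
      norm_num
    simp only [smul_eq_mul]
    rw [e1, ← Real.mul_rpow (by positivity) (by positivity), e2, e3, abs_of_pos (by positivity),
      Real.sqrt_div (by positivity), Real.sqrt_sq ht'.le, add_comm (t ^ 4) 1]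
    have hs : 0 < √(1 + t ^ 4) := Real.sqrt_pos.2 hq
    have hs2 : √(1 + t ^ 4) ^ 2 = 1 + t ^ 4 := Real.sq_sqrt hq.le
    rw [← hs2]
    have hs3 : √(√(1 + t ^ 4) ^ 2) = √(1 + t ^ 4) := Real.sqrt_sq hs.le
    rw [hs3]
    field_simp
  rw [h2] at h
  have hpi : √Real.pi ≠ 0 := (Real.sqrt_pos.2 Real.pi_pos).ne'
  field_simp at h ⊢
  linarith

/-- The substitution u = (t - a²/t)/2 makes u² + a² a perfect square, while b² = a²/2 removes the
middle term of the other factor and leaves (t⁴ + a⁴)/(4t²). -/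
theorem gaussIntegral_lemniscatic {a b : ℝ} (ha : 0 < a) (hab : a ^ 2 = 2 * b ^ 2) :
    gaussIntegral a b = Real.Gamma (1 / 4) ^ 2 / (2 * √Real.pi * a) := by
  have hm : 0 < a ^ 2 := by positivity
  have key := integral_comp_mul_left_Ioi (fun t : ℝ => 2 / √(t ^ 4 + (a ^ 2) ^ 2)) 0 ha
  rw [mul_zero] at key
  have e1 : ∫ t in Ioi (0 : ℝ), 2 / √((a * t) ^ 4 + (a ^ 2) ^ 2) =
      2 / a ^ 2 * ∫ t in Ioi (0 : ℝ), 1 / √(t ^ 4 + 1) := by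
    rw [← integral_const_mul]
    congr 1
    ext t
    have : (a * t) ^ 4 + (a ^ 2) ^ 2 = (a ^ 2) ^ 2 * (t ^ 4 + 1) := by ring
    rw [this, Real.sqrt_mul (by positivity), Real.sqrt_sq hm.le]
    have hs : √(t ^ 4 + 1) ≠ 0 := (Real.sqrt_pos.2 (by positivity)).ne'
    field_simp
  rw [e1, integral_Ioi_inv_sqrt_one_add_pow_four, smul_eq_mul] at key
  have e2 : gaussIntegral a b = ∫ t in Ioi (0 : ℝ), 2 / √(t ^ 4 + (a ^ 2) ^ 2) := by
    rw [gaussIntegral, integral_eq_integral_Ioi_sub_div hm]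
    refine setIntegral_congr_fun measurableSet_Ioi fun t ht => ?_
    have ht' : 0 < t := ht
    have e : (((t - a ^ 2 / t) / 2) ^ 2 + a ^ 2) * (((t - a ^ 2 / t) / 2) ^ 2 + b ^ 2) =
        (t ^ 4 + (a ^ 2) ^ 2) * ((t ^ 2 + a ^ 2) / (4 * t ^ 2)) ^ 2 := by
      rw [show b ^ 2 = a ^ 2 / 2 by linarith]
      field_simp
      ring
    rw [e, Real.sqrt_mul (by positivity), Real.sqrt_sq (by positivity)]
    have hs : √(t ^ 4 + (a ^ 2) ^ 2) ≠ 0 := (Real.sqrt_pos.2 (by positivity)).ne'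
    field_simp
    ring
  rw [e2]
  have hpi : √Real.pi ≠ 0 := (Real.sqrt_pos.2 Real.pi_pos).ne'
  field_simp at key ⊢
  linarith

theorem thetaOmega_eq : thetaOmega = Real.pi ^ 2 * thetaThree 1 ^ 8 / 2 := by
  have hpos := thetaThree_pos one_pos
  have h := gaussIntegral_lemniscatic (a := thetaThree 1 ^ 2) (b := thetaFour 1 ^ 2)
    (by positivity) (by linear_combination thetaThree_one_pow_four)
  rw [gaussIntegral_thetaThree_sq_thetaFour_sq one_pos] at h
  have hs : 0 < √Real.pi := Real.sqrt_pos.2 Real.pi_pos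
  have hs2 : √Real.pi ^ 2 = Real.pi := Real.sq_sqrt Real.pi_pos.le
  have hpi := Real.pi_pos
  have h2 : Real.Gamma (1 / 4) ^ 2 = Real.pi * (2 * √Real.pi * thetaThree 1 ^ 2) := by
    rw [eq_div_iff (by positivity)] at h
    exact h.symm
  rw [thetaOmega, show Real.Gamma (1 / 4) ^ 8 = (Real.Gamma (1 / 4) ^ 2) ^ 4 by ring, h2]
  rw [show (Real.pi * (2 * √Real.pi * thetaThree 1 ^ 2)) ^ 4 =
    16 * Real.pi ^ 4 * (√Real.pi ^ 2) ^ 2 * thetaThree 1 ^ 8 by ring, hs2]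
  field_simp
  norm_num

/-! ### The integer polynomials -/

open Polynomial

/-- The polynomials in the modulus that express the covariant derivatives of `θ₃`. -/
noncomputable def thetaPoly : ℕ → ℤ[X]
  | 0 => 1
  | 1 => 0
  | j + 2 => (1 - 8 * X ^ 2) *
      (derivative (thetaPoly (j + 1)) + (((j + 1) * (2 * j + 1) : ℕ) : ℤ[X]) * thetaPoly j)

theorem thetaPoly_zero : thetaPoly 0 = 1 := by rw [thetaPoly]

theorem thetaPoly_one : thetaPoly 1 = 0 := by rw [thetaPoly]

theorem thetaPoly_add_two (j : ℕ) : thetaPoly (j + 2) = (1 - 8 * X ^ 2) *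
    (derivative (thetaPoly (j + 1)) + (((j + 1) * (2 * j + 1) : ℕ) : ℤ[X]) * thetaPoly j) := by
  rw [thetaPoly]

/-- Differentiation flips parity and 1 - 8X² is even, so the recursion preserves the pattern. -/
theorem thetaPoly_comp_neg_X (j : ℕ) :
    (thetaPoly j).comp (-X) = (-1) ^ j * thetaPoly j := by
  induction j using Nat.twoStepInduction with
  | zero => simp [thetaPoly_zero]
  | one => simp [thetaPoly_one]
  | more j h0 h1 =>
    have h2 : (derivative (thetaPoly (j + 1))).comp (-X) =
        (-1) ^ j * derivative (thetaPoly (j + 1)) := by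
      have h := congrArg derivative h1
      have e : ((-1 : ℤ[X]) ^ (j + 1)) = C ((-1) ^ (j + 1)) := by simp
      rw [derivative_comp, e, derivative_C_mul, ← e] at h
      simp only [derivative_neg, derivative_X] at h
      linear_combination -h
    have h8 : (8 : ℤ[X]).comp (-X) = 8 := by simp
    rw [thetaPoly_add_two, mul_comp, add_comp, h2, mul_comp, natCast_comp, h0, sub_comp, one_comp,
      mul_comp, h8, X_pow_comp]
    ring

theorem thetaPoly_eval_zero_of_odd {j : ℕ} (hj : Odd j) : (thetaPoly j).eval 0 = 0 := by
  have h := congrArg (eval 0) (thetaPoly_comp_neg_X j)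
  rw [hj.neg_one_pow] at h
  simp at h
  omega

theorem thetaPoly_two : thetaPoly 2 =
    1 - 8 * X ^ 2 := by
  rw [thetaPoly_add_two, thetaPoly_one, thetaPoly_zero]
  simp

theorem thetaPoly_three : thetaPoly 3 =
    -16 * X + 128 * X ^ 3 := by
  rw [thetaPoly_add_two, thetaPoly_two, thetaPoly_one]
  simp
  ring

theorem thetaPoly_four : thetaPoly 4 =
    -1 + 272 * X ^ 2 - 2112 * X ^ 4 := by
  rw [thetaPoly_add_two, thetaPoly_three, thetaPoly_two]
  simp
  ring

theorem thetaPoly_five : thetaPoly 5 =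
    96 * X - 5632 * X ^ 3 + 38912 * X ^ 5 := by
  rw [thetaPoly_add_two, thetaPoly_four, thetaPoly_three]
  simp
  ring

theorem thetaPoly_six : thetaPoly 6 =
    51 - 5064 * X ^ 2 + 136768 * X ^ 4 - 796160 * X ^ 6 := by
  rw [thetaPoly_add_two, thetaPoly_five, thetaPoly_four]
  simp
  ring

theorem thetaPoly_seven : thetaPoly 7 =
    -3792 * X + 205696 * X ^ 3 - 3611648 * X ^ 5 + 17670144 * X ^ 7 := by
  rw [thetaPoly_add_two, thetaPoly_six, thetaPoly_five]
  simp
  ring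

theorem thetaPoly_eight : thetaPoly 8 =
    849 + 149472 * X ^ 2 - 6862464 * X ^ 4 + 96139264 * X ^ 6 - 409923584 * X ^ 8 := by
  rw [thetaPoly_add_two, thetaPoly_seven, thetaPoly_six]
  simp
  ring

theorem thetaPoly_nine : thetaPoly 9 =
    -156096 * X - 1517568 * X ^ 3 + 165568512 * X ^ 5 - 2306473984 * X ^ 7 + 9271771136 * X ^ 9 := by
  rw [thetaPoly_add_two, thetaPoly_eight, thetaPoly_seven]
  simp
  ring

theorem thetaPoly_ten : thetaPoly 10 =
    -26199 + 18526104 * X ^ 2 - 368646528 * X ^ 4 + 340904960 * X ^ 6 + 32215715840 * X ^ 8 - 165821054976 * X ^ 10 := by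
  rw [thetaPoly_add_two, thetaPoly_nine, thetaPoly_eight]
  simp
  ring

theorem thetaPoly_eleven : thetaPoly 11 =
    7393968 * X - 1822075776 * X ^ 3 + 47606839296 * X ^ 5 - 448531906560 * X ^ 7 + 1547460608000 * X ^ 9 - 827407728640 * X ^ 11 := by
  rw [thetaPoly_add_two, thetaPoly_ten, thetaPoly_nine]
  simp
  ring

theorem thetaPoly_twelve_eval_zero : (thetaPoly 12).eval 0 = 1341999 := by
  rw [thetaPoly_add_two, thetaPoly_eleven, thetaPoly_ten]
  simp

/-! ### Weights of the covariant derivatives -/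

/-- The weights of the covariant derivatives in the ordinary derivatives of `θ₃`. -/
noncomputable def covariantCoeff (n j : ℕ) : ℝ :=
  ((2 * n).factorial : ℝ) / n.factorial * (j.factorial / (2 * j).factorial) * n.choose j

theorem covariantCoeff_eq {n j : ℕ} (h : j ≤ n) :
    covariantCoeff n j = ((2 * n).factorial : ℝ) / ((2 * j).factorial * (n - j).factorial) := by
  rw [covariantCoeff, Nat.cast_choose ℝ h]
  have h1 := Nat.cast_ne_zero (R := ℝ).2 n.factorial_ne_zero
  have h2 := Nat.cast_ne_zero (R := ℝ).2 j.factorial_ne_zero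
  field_simp

/-- The binomial coefficient in the definition ensures this; under truncated subtraction the
quotient in `covariantCoeff_eq` would not vanish here. -/
theorem covariantCoeff_succ_self (n : ℕ) : covariantCoeff n (n + 1) = 0 := by
  simp [covariantCoeff]

theorem cast_factorial_two_mul_succ (n : ℕ) :
    ((2 * (n + 1)).factorial : ℝ) = (2 * n + 2) * (2 * n + 1) * (2 * n).factorial := by
  rw [show 2 * (n + 1) = 2 * n + 1 + 1 by ring, Nat.factorial_succ, Nat.factorial_succ]
  push_cast
  ring

theorem cast_choose_succ_right (n j : ℕ) :
    ((j : ℝ) + 1) * n.choose (j + 1) = ((n - j : ℕ) : ℝ) * n.choose j := by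
  have := Nat.choose_succ_right_eq n j
  rw [mul_comm, mul_comm (((n - j : ℕ) : ℝ))]
  exact_mod_cast this

theorem covariantCoeff_succ_right (n j : ℕ) :
    2 * (covariantCoeff n (j + 1) * ((j + 1) * (2 * j + 1))) =
      covariantCoeff n j * ((n - j : ℕ) : ℝ) := by
  have h := cast_choose_succ_right n j
  rw [covariantCoeff, covariantCoeff, cast_factorial_two_mul_succ, Nat.factorial_succ]
  have h1 := Nat.cast_ne_zero (R := ℝ).2 n.factorial_ne_zero
  have h2 := Nat.cast_ne_zero (R := ℝ).2 (2 * j).factorial_ne_zero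
  have h3 : (j : ℝ) + 1 ≠ 0 := by positivity
  have h4 : 2 * (j : ℝ) + 1 ≠ 0 := by positivity
  push_cast
  field_simp
  linear_combination h

theorem covariantCoeff_succ_zero (n : ℕ) :
    covariantCoeff (n + 1) 0 = covariantCoeff n 0 * (4 * n + 2) := by
  rw [covariantCoeff, covariantCoeff, cast_factorial_two_mul_succ, Nat.factorial_succ]
  have h1 := Nat.cast_ne_zero (R := ℝ).2 n.factorial_ne_zero
  have h3 : (n : ℝ) + 1 ≠ 0 := by positivity
  push_cast
  simp
  field_simp
  ring

theorem covariantCoeff_succ_succ {n j : ℕ} (hj : j ≤ n) :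
    covariantCoeff (n + 1) (j + 1) =
      covariantCoeff n (j + 1) * (4 * n + 4 * j + 6) + covariantCoeff n j := by
  have h := cast_choose_succ_right n j
  rw [Nat.cast_sub hj] at h
  rw [covariantCoeff, covariantCoeff, covariantCoeff, cast_factorial_two_mul_succ,
    cast_factorial_two_mul_succ, Nat.factorial_succ, Nat.factorial_succ, Nat.choose_succ_succ]
  have h1 := Nat.cast_ne_zero (R := ℝ).2 n.factorial_ne_zero
  have h2 := Nat.cast_ne_zero (R := ℝ).2 (2 * j).factorial_ne_zero
  have h3 : (j : ℝ) + 1 ≠ 0 := by positivity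
  have h4 : 2 * (j : ℝ) + 1 ≠ 0 := by positivity
  have h5 : (n : ℝ) + 1 ≠ 0 := by positivity
  push_cast
  field_simp
  linear_combination (-4 : ℝ) * h

/-- The combination of covariant derivatives `G` that gives an ordinary derivative. -/
noncomputable def covariantSum (n : ℕ) (v : ℝ) (G : ℕ → ℝ) : ℝ :=
  ∑ j ∈ Finset.range (n + 1), covariantCoeff n j * v ^ (n - j) * G j

/-- The left side is the derivative of the sum when v' = 4v² + M/2 and G_j' = G_{j+1} + (2 + 8j)vG_j
- j(2j - 1)MG_{j-1}. The weights are such that the M-terms cancel and the others obey a Pascal-type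
recursion. -/
theorem covariantSum_succ (n : ℕ) (v M : ℝ) (G : ℕ → ℝ) :
    ∑ j ∈ Finset.range (n + 1), covariantCoeff n j *
      (((n - j : ℕ) : ℝ) * v ^ (n - j - 1) * (4 * v ^ 2 + M / 2) * G j +
        v ^ (n - j) * (G (j + 1) + (2 + 8 * j) * v * G j - j * (2 * j - 1) * M * G (j - 1))) =
      covariantSum (n + 1) v G := by
  -- Cancellation of the M-terms after a shift of index: the left sum loses j = n through n - j = 0,
  -- the right one j = 0 through its factor j.
  have hS : ∑ j ∈ Finset.range (n + 1),
      covariantCoeff n j * ((n - j : ℕ) : ℝ) * (v ^ (n - j - 1) * (M / 2) * G j) =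
      ∑ j ∈ Finset.range (n + 1),
        covariantCoeff n j * (j * (2 * j - 1)) * (v ^ (n - j) * M * G (j - 1)) := by
    rw [Finset.sum_range_succ, Finset.sum_range_succ']
    simp only [Nat.sub_self, Nat.cast_zero, mul_zero, zero_mul, add_zero]
    refine Finset.sum_congr rfl fun j _ => ?_
    have h := covariantCoeff_succ_right n j
    rw [Nat.add_sub_cancel, ← Nat.sub_sub]
    push_cast
    linear_combination (-(v ^ (n - j - 1) * (M / 2) * G j)) * h
  have hT : covariantSum (n + 1) v G =
      ∑ j ∈ Finset.range (n + 1), covariantCoeff n j * (4 * n + 4 * j + 2) * v ^ (n + 1 - j) * G j +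
      ∑ j ∈ Finset.range (n + 1), covariantCoeff n j * v ^ (n - j) * G (j + 1) := by
    have h0 : ∑ j ∈ Finset.range (n + 1),
        covariantCoeff n j * (4 * n + 4 * j + 2) * v ^ (n + 1 - j) * G j =
        ∑ j ∈ Finset.range (n + 2),
        covariantCoeff n j * (4 * n + 4 * j + 2) * v ^ (n + 1 - j) * G j := by
      rw [Finset.sum_range_succ _ (n + 1), covariantCoeff_succ_self]
      ring
    rw [h0, covariantSum, Finset.sum_range_succ', Finset.sum_range_succ' _ (n + 1),
      covariantCoeff_succ_zero, add_right_comm, ← Finset.sum_add_distrib]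
    congr 1
    · refine Finset.sum_congr rfl fun j hj => ?_
      rw [covariantCoeff_succ_succ (Nat.lt_succ_iff.1 (Finset.mem_range.1 hj)),
        Nat.add_sub_add_right]
      push_cast
      ring
    · push_cast
      ring
  rw [hT, ← Finset.sum_add_distrib]
  rw [← sub_eq_zero] at hS
  rw [← sub_eq_zero, ← hS, ← Finset.sum_sub_distrib, ← Finset.sum_sub_distrib]
  refine Finset.sum_congr rfl fun j hj => ?_
  have hjn : j ≤ n := Nat.lt_succ_iff.1 (Finset.mem_range.1 hj)
  obtain ⟨d, rfl⟩ := Nat.exists_eq_add_of_le hjn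
  rw [show j + d - j = d by omega, show j + d + 1 - j = d + 1 by omega]
  have hv : (d : ℝ) * v ^ (d - 1) * v ^ 2 = d * v ^ (d + 1) := by
    cases d with
    | zero => simp
    | succ d => rw [Nat.add_sub_cancel]; ring
  push_cast
  linear_combination (4 * covariantCoeff (j + d) j * G j) * hv

theorem hasDerivAt_covariantSum {v : ℝ → ℝ} {G : ℕ → ℝ → ℝ} {M x : ℝ}
    (hv : HasDerivAt v (4 * v x ^ 2 + M / 2) x)
    (hG : ∀ j, HasDerivAt (G j)
      (G (j + 1) x + (2 + 8 * j) * v x * G j x - j * (2 * j - 1) * M * G (j - 1) x) x) (n : ℕ) :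
    HasDerivAt (fun y => covariantSum n (v y) fun j => G j y)
      (covariantSum (n + 1) (v x) fun j => G j x) x := by
  rw [← covariantSum_succ n (v x) M]
  refine HasDerivAt.fun_sum fun j _ => ?_
  have h := ((hv.pow (n - j)).mul (hG j)).const_mul (covariantCoeff n j)
  have e : (fun y => covariantCoeff n j * v y ^ (n - j) * G j y) =
      fun y => covariantCoeff n j * ((v ^ (n - j)) * G j) y := by
    ext y
    simp only [Pi.mul_apply, Pi.pow_apply]
    ring
  rw [e]
  exact h.congr_deriv rfl

/-! ### Covariant derivatives of θ₃ -/

/-- The normalized modulus, centred at the fixed point `1` of `x ↦ 1 / x`. -/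
noncomputable def thetaModulus (x : ℝ) : ℝ := (thetaFour x ^ 4 / thetaThree x ^ 4 - 1 / 2) / √2

/-- The normalized weight-two form `π θ₃⁴ / (4 √2)`. -/
noncomputable def thetaWeight (x : ℝ) : ℝ := Real.pi / (4 * √2) * thetaThree x ^ 4

/-- The covariant derivatives of `θ₃`. -/
noncomputable def thetaCovariant (j : ℕ) (x : ℝ) : ℝ :=
  thetaThree x * thetaWeight x ^ j * aeval (thetaModulus x) (thetaPoly j)

theorem hasDerivAt_thetaWeight {x : ℝ} (hx : 0 < x) :
    HasDerivAt thetaWeight (4 * logDerivThree x * thetaWeight x) x := by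
  have h := ((hasDerivAt_thetaThree hx).pow 4).const_mul (Real.pi / (4 * √2))
  refine HasDerivAt.congr_deriv h ?_
  rw [thetaWeight]
  norm_num
  ring

theorem sq_sqrt_two : √2 ^ 2 = (2 : ℝ) := Real.sq_sqrt zero_le_two

theorem one_sub_eight_mul_thetaModulus_sq {x : ℝ} (hx : 0 < x) :
    (1 - 8 * thetaModulus x ^ 2) * thetaThree x ^ 8 =
      4 * thetaFour x ^ 4 * thetaTwoPowFour x := by
  have h := (thetaThree_pos hx).ne'
  rw [thetaModulus, div_pow, sq_sqrt_two, thetaTwoPowFour]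
  field_simp
  ring

theorem thetaWeight_sq (x : ℝ) : thetaWeight x ^ 2 = Real.pi ^ 2 / 32 * thetaThree x ^ 8 := by
  rw [thetaWeight, mul_pow, div_pow, mul_pow, sq_sqrt_two]
  ring

theorem hasDerivAt_thetaModulus {x : ℝ} (hx : 0 < x) :
    HasDerivAt thetaModulus (thetaWeight x * (1 - 8 * thetaModulus x ^ 2)) x := by
  have h3 := (thetaThree_pos hx).ne'
  have h := ((((hasDerivAt_thetaFour hx).pow 4).div ((hasDerivAt_thetaThree hx).pow 4)
    (pow_ne_zero 4 h3)).sub_const (1 / 2)).div_const (√2)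
  refine HasDerivAt.congr_deriv h ?_
  have e := one_sub_eight_mul_thetaModulus_sq hx
  have e2 : 1 - 8 * thetaModulus x ^ 2 =
      4 * thetaFour x ^ 4 * thetaTwoPowFour x / thetaThree x ^ 8 := by
    rw [← e]; field_simp
  have e3 := logDerivThree_sub_logDerivFour hx
  have e4 : logDerivFour x = logDerivThree x + Real.pi / 4 * thetaTwoPowFour x := by linarith
  rw [e2, thetaWeight, e4]
  have hs : √(2 : ℝ) ≠ 0 := (Real.sqrt_pos.2 zero_lt_two).ne'
  simp only [Pi.pow_apply]
  norm_num
  field_simp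
  ring

/-- The factor θ₃W^j contributes (2 + 8j)v, and the chain rule contributes W(1 - 8m²)P_j'(m), which
the recursion of `thetaPoly` splits into the terms with indices j + 1 and j - 1. -/
theorem hasDerivAt_thetaCovariant {x : ℝ} (hx : 0 < x) (j : ℕ) :
    HasDerivAt (thetaCovariant j)
      (thetaCovariant (j + 1) x + (2 + 8 * j) * (logDerivThree x / 2) * thetaCovariant j x -
        j * (2 * j - 1) * (thetaWeight x ^ 2 * (1 - 8 * thetaModulus x ^ 2)) *
          thetaCovariant (j - 1) x) x := by
  have hp := ((thetaPoly j).hasDerivAt_aeval (thetaModulus x)).comp x (hasDerivAt_thetaModulus hx)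
  have h := ((hasDerivAt_thetaThree hx).mul ((hasDerivAt_thetaWeight hx).pow j)).mul hp
  refine HasDerivAt.congr_deriv h ?_
  simp only [Pi.mul_apply, Pi.pow_apply, Function.comp_apply, thetaCovariant]
  cases j with
  | zero =>
    simp only [zero_add, thetaPoly_zero, thetaPoly_one, map_one, map_zero, derivative_one]
    push_cast
    ring
  | succ j =>
    rw [thetaPoly_add_two, Nat.add_sub_cancel]
    simp only [map_mul, map_add, map_sub, map_one, map_pow, aeval_X, map_natCast, map_ofNat]
    push_cast
    ring

theorem hasDerivAt_half_logDerivThree {x : ℝ} (hx : 0 < x) :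
    HasDerivAt (fun y => logDerivThree y / 2) (4 * (logDerivThree x / 2) ^ 2 +
      thetaWeight x ^ 2 * (1 - 8 * thetaModulus x ^ 2) / 2) x := by
  refine ((hasDerivAt_logDerivThree hx).div_const 2).congr_deriv ?_
  rw [thetaWeight_sq]
  linear_combination (-Real.pi ^ 2 / 64) * one_sub_eight_mul_thetaModulus_sq hx

/-- Restricted to the real axis, each complex derivative is again a derivative along the line, so
the real differential system drives the induction. -/
theorem iteratedDeriv_jacobiTheta3_ofReal (n : ℕ) : ∀ {x : ℝ}, 0 < x →
    iteratedDeriv n jacobiTheta3 x =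
      (covariantSum n (logDerivThree x / 2) fun j => thetaCovariant j x : ℝ) := by
  induction n with
  | zero =>
    intro x _
    simp [covariantSum, covariantCoeff, thetaCovariant, thetaPoly_zero,
      jacobiTheta3_ofReal_eq_thetaThree]
  | succ n ih =>
    intro x hx
    have h1 := (differentiableAt_iteratedDeriv_jacobiTheta3 n
      (z := (x : ℂ)) (by simpa using hx)).hasDerivAt.comp_ofReal
    rw [← iteratedDeriv_succ] at h1
    have h2 := (hasDerivAt_covariantSum (hasDerivAt_half_logDerivThree hx)
      (hasDerivAt_thetaCovariant hx) n).ofReal_comp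
    refine (h1.congr_of_eventuallyEq ?_).unique h2
    filter_upwards [lt_mem_nhds hx] with y hy
    exact (ih hy).symm

/-! ### Evaluation at 1 -/

theorem sum_range_eq_sum_even {f : ℕ → ℝ} (hf : ∀ j, Odd j → f j = 0) (n : ℕ) :
    ∑ j ∈ Finset.range (n + 1), f j = ∑ k ∈ Finset.range (n / 2 + 1), f (2 * k) := by
  induction n with
  | zero => simp
  | succ n ih =>
    rw [Finset.sum_range_succ, ih]
    rcases Nat.even_or_odd (n + 1) with h | h
    · obtain ⟨m, hm⟩ := h
      rw [show (n + 1) / 2 + 1 = (n / 2 + 1) + 1 by omega, Finset.sum_range_succ _ (n / 2 + 1),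
        show 2 * (n / 2 + 1) = n + 1 by omega]
    · obtain ⟨m, hm⟩ := h
      rw [hf (n + 1) ⟨m, hm⟩, show (n + 1) / 2 = n / 2 by omega, add_zero]

theorem thetaCovariant_one (j : ℕ) :
    thetaCovariant j 1 = thetaThree 1 * thetaWeight 1 ^ j * ((thetaPoly j).eval 0 : ℤ) := by
  have h : thetaModulus 1 = 0 := by
    have h4 := (thetaFour_pos one_pos).ne'
    rw [thetaModulus, thetaThree_one_pow_four]
    field_simp
    norm_num
  rw [thetaCovariant, h]
  congr 1
  have := aeval_algebraMap_apply ℝ (0 : ℤ) (thetaPoly j)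
  simpa using this

theorem iteratedDeriv_jacobiTheta3_one (n : ℕ) :
    iteratedDeriv n jacobiTheta3 1 = ((thetaThree 1 * ((-1) ^ n / 4 ^ n) *
      ∑ k ∈ Finset.range (n / 2 + 1), ((2 * n).factorial : ℝ) /
        (2 ^ (n - 2 * k) * ((4 * k).factorial : ℝ) * ((n - 2 * k).factorial : ℝ)) *
        ((thetaPoly (2 * k)).eval 0 : ℤ) * thetaOmega ^ k : ℝ) : ℂ) := by
  have h := iteratedDeriv_jacobiTheta3_ofReal n one_pos
  rw [Complex.ofReal_one] at h
  rw [h, covariantSum, sum_range_eq_sum_even, Finset.mul_sum]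
  · congr 1
    refine Finset.sum_congr rfl fun k hk => ?_
    have hk' : 2 * k ≤ n := by have := Finset.mem_range.1 hk; omega
    obtain ⟨m, rfl⟩ := Nat.exists_eq_add_of_le hk'
    have hW : thetaWeight 1 ^ (2 * k) = thetaOmega ^ k / 16 ^ k := by
      rw [pow_mul, thetaWeight_sq, thetaOmega_eq, ← div_pow]
      congr 1
      ring
    rw [covariantCoeff_eq hk', thetaCovariant_one, logDerivThree_one, hW,
      show 2 * k + m - 2 * k = m by omega, show 2 * (2 * k) = 4 * k by ring]
    -- With n = 2k + m, the power v^m at v = -1/8 supplies the 2^m and part of 4^n; the missing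
    -- 4^(2k) is the 16^k from W² = Ω/16.
    have e1 : (-1 / 4 / 2 : ℝ) ^ m = (-1) ^ m / (4 ^ m * 2 ^ m) := by
      rw [← mul_pow, ← div_pow]; norm_num
    have e2 : (-1 : ℝ) ^ (2 * k + m) / 4 ^ (2 * k + m) = (-1) ^ m / (16 ^ k * 4 ^ m) := by
      rw [pow_add, pow_add, pow_mul, pow_mul]; norm_num
    rw [e1, e2]
    field_simp
  · intro j hj
    rw [thetaCovariant_one, thetaPoly_eval_zero_of_odd hj]
    simp

theorem theorem1 :
    ∃ d : ℕ → ℤ,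
      (d 0 = 1 ∧ d 1 = 1 ∧ d 2 = -1 ∧ d 3 = 51 ∧ d 4 = 849 ∧ d 5 = -26199 ∧ d 6 = 1341999) ∧
      ∀ n : ℕ,
        iteratedDeriv n jacobiTheta3 1 =
          jacobiTheta3 1 * ((-1 : ℂ) ^ n / (4 : ℂ) ^ n) *
            ∑ k ∈ Finset.range (n / 2 + 1),
              ((2 * n).factorial : ℂ) /
                  ((2 : ℂ) ^ (n - 2 * k) * ((4 * k).factorial : ℂ) * ((n - 2 * k).factorial : ℂ)) *
                (d k : ℂ) * (thetaOmega : ℂ) ^ k := by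
  refine ⟨fun k => (thetaPoly (2 * k)).eval 0, ⟨?_, ?_, ?_, ?_, ?_, ?_, ?_⟩, fun n => ?_⟩
  · simp [thetaPoly_zero]
  · simp [thetaPoly_two]
  · simp [thetaPoly_four]
  · simp [thetaPoly_six]
  · simp [thetaPoly_eight]
  · simp [thetaPoly_ten]
  · exact thetaPoly_twelve_eval_zero
  · have h := jacobiTheta3_ofReal_eq_thetaThree 1
    rw [Complex.ofReal_one] at h
    rw [iteratedDeriv_jacobiTheta3_one, h]
    push_cast
    rfl
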